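/- Let $n\ge 1$, let $\alpha,\beta>0$, let $u_0\in L^2(\mathbb R^n)$, and let $u\in C([0,\infty);L^2(\mathbb R^n))$ be the solution of the free Schrödinger initial value problem $$\partial_t u=i\Delta u\quad (t>0,\ x\in\mathbb R^n),\qquad u(x,0)=u_0(x),$$ where the equation is understood in the sense of distributions in $x$: for every Schwartz function $\varphi$ and every $t>0$, the function $s\mapsto\int_{\mathbb R^n}u(x,s)\varphi(x)\,dx$ is differentiable at $s=t$ with derivative $i\int_{\mathbb R^n}u(x,t)\,\Delta\varphi(x)\,dx$. Write $$\widehat f(\xi)=(2\pi)^{-n/2}\int_{\mathbb R^n}e^{-ix\cdot\xi}f(x)\,dx$$ for the Fourier transform, extended to $L^2(\mathbb R^n)$ by Plancherel's theorem, and for $T>0$ put $$\theta(t)=\frac{\beta(T-t)}{T(\alpha t+\beta)},\qquad \mu(t)=\frac{\beta}{\alpha t+\beta}.$$ Weighted norms $\|\cdot\|_2=\|\cdot\|_{L^2(\mathbb R^n)}$ take values in $[0,\infty]$, with the conventions $a^0=1$ for all $a\in[0,\infty]$ and $0\cdot\infty=0$. Let $\gamma=(\gamma_1,\dots,\gamma_n)\in[0,\infty)^n$.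 Then, for every $T>0$ and every $0\le t\le T$, $$\Big\|e^{\sum_{j}\frac{\gamma_jx_j^2}{(\alpha t+\beta)^2}}u(t)\Big\|_2\le\Big\|e^{\sum_j\frac{\gamma_jx_j^2}{\beta^2}}u(0)\Big\|_2^{\theta(t)}\Big\|e^{\sum_j\frac{\gamma_jx_j^2}{(\alpha T+\beta)^2}}u(T)\Big\|_2^{1-\theta(t)},$$ and, for every $t\ge 0$, $$\Big\|e^{\sum_{j}\frac{\gamma_jx_j^2}{(\alpha t+\beta)^2}}u(t)\Big\|_2\le\Big\|e^{\sum_j\frac{\gamma_jx_j^2}{\beta^2}}u(0)\Big\|_2^{\mu(t)}\Big\|e^{\sum_j\frac{4\gamma_j\xi_j^2}{\alpha^2}}\,\widehat u(0)\Big\|_2^{1-\mu(t)}.$$ In particular, in each inequality the left-hand side is finite whenever the right-hand side is. -/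

import Mathlib

open MeasureTheory
open scoped ENNReal SchwartzMap FourierTransform Laplacian

noncomputable section

/-- `L²(ℝⁿ; ℂ)`. -/
abbrev L2Space (n : ℕ) : Type := Lp ℂ 2 (volume : Measure (EuclideanSpace ℝ (Fin n)))

/-- `u` is the solution in `C([0, ∞); L²(ℝⁿ))` of the free Schrödinger initial value problem
`∂ₜ u = i Δ u` for `t > 0`, `u(0) = u₀`; the equation holds in the sense of tempered
distributions in `x`: for each Schwartz function `φ` and each `t > 0`,
`d/dt ∫ u(x, t) φ(x) dx = i ∫ u(x, t) Δφ(x) dx`. -/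
structure IsFreeSchrodingerSolution {n : ℕ} (u₀ : L2Space n) (u : ℝ → L2Space n) : Prop where
  continuousOn : ContinuousOn u (Set.Ici 0)
  initial : u 0 = u₀
  equation : ∀ φ : 𝓢(EuclideanSpace ℝ (Fin n), ℂ), ∀ t : ℝ, 0 < t →
    HasDerivAt (fun s : ℝ => ∫ x, u s x * φ x) (Complex.I * ∫ x, u t x * (Δ φ) x) t

/-- The Fourier transform on `L²(ℝⁿ)` in the unitary angular-frequency normalization,
`f̂(ξ) = (2π)^(-n/2) ∫ e^(-i x·ξ) f(x) dx`, extended from the Schwartz class by Plancherel.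
Mathlib's `𝓕 f` is the `L²` extension of `η ↦ ∫ e^(-2πi x·η) f(x) dx`, so that
`f̂(ξ) = (2π)^(-n/2) (𝓕 f)(ξ / 2π)`. -/
def angularFourier {n : ℕ} (f : L2Space n) : EuclideanSpace ℝ (Fin n) → ℂ :=
  fun ξ => (((2 * Real.pi) ^ (-(n : ℝ) / 2) : ℝ) : ℂ) * (𝓕 f : L2Space n) ((2 * Real.pi)⁻¹ • ξ)

/-- The weighted norm `‖exp(∑ⱼ cⱼ xⱼ²) f‖_{L²(ℝⁿ)}`, with values in `[0, ∞]`. -/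
def gaussianNorm {n : ℕ} (c : Fin n → ℝ) (f : EuclideanSpace ℝ (Fin n) → ℂ) : ℝ≥0∞ :=
  eLpNorm (fun x => ((Real.exp (∑ j, c j * x j ^ 2) : ℝ) : ℂ) * f x) 2 volume

end

open scoped NNReal

/-!
Put `X = x` and `P = -i∇`. The Gaussian weight is an average of the weights `exp(s·x)` over a
centred Gaussian `s`, and `exp(-itΔ) exp(s·X) exp(itΔ) = exp(s·(X + 2tP))`, so
`‖exp(s·x) u(t)‖` is the norm of `exp(s·X + 2t s·P) u₀`; likewise `‖exp(s·ξ) û₀‖` is the norm of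
`exp(s·P) u₀`. All these Weyl operators have the form `exp(c·X + d·P)` with `(c, d)` real, and
imaginary `(c, d)` give unitary operators. By the three lines theorem the norm of
`exp(c·X + d·P) u₀` is therefore log-convex in `(c, d)`. The time-dependent weights of the theorem
are those for which the parameters of the three norms are collinear, and Hölder's inequality
passes to the Gaussian average.
-/

section Pairing

variable {X : Type*} [MeasurableSpace X] {ν : Measure X}

lemma enorm_integral_mul_le {f g : X → ℂ} (hf : AEStronglyMeasurable f ν)
    (hg : AEStronglyMeasurable g ν) :
    ‖∫ x, f x * g x ∂ν‖ₑ ≤ eLpNorm f 2 ν * eLpNorm g 2 ν := by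
  refine (enorm_integral_le_lintegral_enorm _).trans ?_
  rw [← eLpNorm_one_eq_lintegral_enorm]
  change eLpNorm (f • g) 1 ν ≤ _
  exact eLpNorm_smul_le_mul_eLpNorm hg hf

lemma continuous_integral_mul_Lp (U : Lp ℂ 2 ν) :
    Continuous fun W : Lp ℂ 2 ν => ∫ x, U x * W x ∂ν :=
  ((ContinuousLinearMap.mul ℂ ℂ).lpPairing ν 2 2 U).continuous.congr fun W =>
    ContinuousLinearMap.lpPairing_eq_integral _ U W

lemma integral_star_mul (U W : Lp ℂ 2 ν) :
    ∫ x, (star U : Lp ℂ 2 ν) x * W x ∂ν = inner ℂ U W := by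
  rw [L2.inner_def]
  refine integral_congr_ae ?_
  filter_upwards [Lp.coeFn_star U] with x hx
  rw [hx, RCLike.inner_apply, mul_comm]
  rfl

/-- Extend `T e ↦ ∫ F * T e` by density and apply the Riesz representation theorem. -/
lemma exists_Lp_integral_mul_eq {E : Type*} [AddCommGroup E] [Module ℂ E]
    {T : E →ₗ[ℂ] Lp ℂ 2 ν} (hT : DenseRange T) {F : X → ℂ}
    (hF : ∀ e, Integrable (fun x => F x * T e x) ν) {M : ℝ≥0}
    (h : ∀ e, ‖∫ x, F x * T e x ∂ν‖ₑ ≤ M * ‖T e‖ₑ) :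
    ∃ y : Lp ℂ 2 ν, ‖y‖ₑ ≤ M ∧ ∀ e, ∫ x, F x * T e x ∂ν = ∫ x, y x * T e x ∂ν := by
  let ℓ : E →ₗ[ℂ] ℂ :=
    { toFun := fun e => ∫ x, F x * T e x ∂ν
      map_add' := fun e e' => by
        rw [← integral_add (hF e) (hF e'), map_add]
        refine integral_congr_ae ?_
        filter_upwards [Lp.coeFn_add (T e) (T e')] with x hx
        rw [hx, Pi.add_apply, mul_add]
      map_smul' := fun a e => by
        rw [RingHom.id_apply, smul_eq_mul, ← integral_const_mul, map_smul]
        refine integral_congr_ae ?_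
        filter_upwards [Lp.coeFn_smul a (T e)] with x hx
        rw [hx, Pi.smul_apply, smul_eq_mul, mul_left_comm] }
  have hℓ : ∀ e, ‖ℓ e‖ ≤ M * ‖T e‖ := fun e => by
    have he := h e
    rw [enorm_eq_nnnorm, enorm_eq_nnnorm, ← ENNReal.coe_mul, ENNReal.coe_le_coe] at he
    exact he
  set z : Lp ℂ 2 ν := (InnerProductSpace.toDual ℂ _).symm (ℓ.extendOfNorm T) with hz
  have hzM : ‖z‖ ≤ M := by
    rw [hz, LinearIsometryEquiv.norm_map]
    exact LinearMap.opNorm_extendOfNorm_le hT M.2 hℓ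
  refine ⟨star z, ?_, fun e => ?_⟩
  · rw [Lp.enorm_def, eLpNorm_congr_ae (Lp.coeFn_star z), eLpNorm_star, ← Lp.enorm_def]
    rw [enorm_eq_nnnorm, ENNReal.coe_le_coe]
    exact hzM
  · calc ∫ x, F x * T e x ∂ν = inner ℂ z (T e) := by
          rw [hz, InnerProductSpace.toDual_symm_apply, LinearMap.extendOfNorm_eq hT ⟨M, hℓ⟩]
          rfl
      _ = ∫ x, (star z : Lp ℂ 2 ν) x * T e x ∂ν := (integral_star_mul z (T e)).symm

end Pairing

section Plancherel

variable {V : Type*} [NormedAddCommGroup V] [InnerProductSpace ℝ V] [FiniteDimensional ℝ V]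
  [MeasurableSpace V] [BorelSpace V]

lemma fourier_add_of_integrable {f g : V → ℂ} (hf : Integrable f) (hg : Integrable g) :
    𝓕 (f + g) = 𝓕 f + 𝓕 g :=
  VectorFourier.fourierIntegral_add (L := innerₗ V) Real.continuous_fourierChar
    continuous_inner hf hg

lemma fourier_const_smul (a : ℂ) (f : V → ℂ) : 𝓕 (a • f) = a • 𝓕 f :=
  VectorFourier.fourierIntegral_const_smul Real.fourierChar volume (innerₗ V) f a

lemma integral_fourier_mul_of_integrable {f g : V → ℂ} (hf : Integrable f) (hg : Integrable g) :
    ∫ ξ, 𝓕 f ξ * g ξ = ∫ x, f x * 𝓕 g x := by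
  simpa using! VectorFourier.integral_bilin_fourierIntegral_eq_flip (ContinuousLinearMap.mul ℂ ℂ)
    (L := innerₗ V) (μ := volume) (ν := volume) Real.continuous_fourierChar continuous_inner hf hg

lemma integral_Lp_fourier_mul_schwartz (U : Lp ℂ 2 (volume : Measure V)) (φ : 𝓢(V, ℂ)) :
    ∫ ξ, (𝓕 U : Lp ℂ 2 (volume : Measure V)) ξ * φ ξ = ∫ x, U x * 𝓕 φ x := by
  have h := DFunLike.congr_fun (Lp.fourier_toTemperedDistribution_eq U) φ
  simp only [TemperedDistribution.fourier_apply, Lp.toTemperedDistribution_apply,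
    smul_eq_mul] at h
  simpa only [mul_comm] using h.symm

lemma integral_Lp_fourier_mul (U W : Lp ℂ 2 (volume : Measure V)) :
    ∫ ξ, (𝓕 U : Lp ℂ 2 (volume : Measure V)) ξ * W ξ =
      ∫ x, U x * (𝓕 W : Lp ℂ 2 (volume : Measure V)) x := by
  refine (SchwartzMap.denseRange_toLpCLM (F := ℂ) (p := 2) ENNReal.ofNat_ne_top).induction_on W
    (isClosed_eq (continuous_integral_mul_Lp _) ((continuous_integral_mul_Lp _).comp
      (Lp.fourierTransformₗᵢ V ℂ).continuous)) fun φ => ?_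
  rw [SchwartzMap.toLpCLM_apply, SchwartzMap.toLp_fourier_eq]
  calc _ = ∫ ξ, (𝓕 U : Lp ℂ 2 (volume : Measure V)) ξ * φ ξ :=
        integral_congr_ae (Filter.EventuallyEq.rfl.fun_mul (φ.coeFn_toLp 2 volume))
    _ = ∫ x, U x * 𝓕 φ x := integral_Lp_fourier_mul_schwartz U φ
    _ = _ :=
        integral_congr_ae (Filter.EventuallyEq.rfl.fun_mul ((𝓕 φ).coeFn_toLp 2 volume).symm)

lemma ae_eq_of_integral_mul_schwartz_eq {f g : V → ℂ} (hf : LocallyIntegrable f)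
    (hg : LocallyIntegrable g)
    (h : ∀ φ : 𝓢(V, ℂ), HasCompactSupport φ → ∫ x, f x * φ x = ∫ x, g x * φ x) :
    f =ᵐ[volume] g := by
  refine ae_eq_of_integral_contDiff_smul_eq hf hg fun ψ hψ hψc => ?_
  have hc : HasCompactSupport fun x => (ψ x : ℂ) := hψc.comp_left Complex.ofReal_zero
  have hswap : ∀ F : V → ℂ, ∫ x, ψ x • F x = ∫ x, F x * (ψ x : ℂ) := fun F =>
    integral_congr_ae (.of_forall fun x => mul_comm (ψ x : ℂ) _)
  rw [hswap, hswap]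
  exact h (hc.toSchwartzMap (Complex.ofRealCLM.contDiff.comp hψ)) hc

lemma locallyIntegrable_fourier {g : V → ℂ} (hg : Integrable g) : LocallyIntegrable (𝓕 g) :=
  (VectorFourier.fourierIntegral_continuous Real.continuous_fourierChar
    (L := innerₗ V) continuous_inner hg).locallyIntegrable

lemma fourier_toLp_ae_eq {g : V → ℂ} (hg : Integrable g) (hg2 : MemLp g 2) :
    (𝓕 (hg2.toLp g) : Lp ℂ 2 (volume : Measure V)) =ᵐ[volume] 𝓕 g := by
  refine ae_eq_of_integral_mul_schwartz_eq ((Lp.memLp _).locallyIntegrable one_le_two)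
    (locallyIntegrable_fourier hg) fun φ _ => ?_
  calc _ = ∫ x, hg2.toLp g x * 𝓕 φ x := integral_Lp_fourier_mul_schwartz _ φ
    _ = ∫ x, g x * 𝓕 φ x :=
        integral_congr_ae (hg2.coeFn_toLp.fun_mul .rfl)
    _ = ∫ ξ, 𝓕 g ξ * φ ξ := (integral_fourier_mul_of_integrable hg φ.integrable).symm

lemma eLpNorm_fourier_eq {g : V → ℂ} (hg : Integrable g) (hg2 : MemLp g 2) :
    eLpNorm (𝓕 g) 2 = eLpNorm g 2 := by
  rw [← eLpNorm_congr_ae (fourier_toLp_ae_eq hg hg2), ← Lp.enorm_def, ← ofReal_norm,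
    Lp.norm_fourier_eq, ofReal_norm, Lp.enorm_toLp]

lemma integral_Lp_fourier_mul_eq (U : Lp ℂ 2 (volume : Measure V)) {g : V → ℂ}
    (hg : Integrable g) (hg2 : MemLp g 2) :
    ∫ ξ, (𝓕 U : Lp ℂ 2 (volume : Measure V)) ξ * g ξ = ∫ x, U x * 𝓕 g x := by
  calc _ = ∫ ξ, (𝓕 U : Lp ℂ 2 (volume : Measure V)) ξ * hg2.toLp g ξ :=
        integral_congr_ae (Filter.EventuallyEq.rfl.fun_mul hg2.coeFn_toLp.symm)
    _ = ∫ x, U x * (𝓕 (hg2.toLp g) : Lp ℂ 2 (volume : Measure V)) x :=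
        integral_Lp_fourier_mul U _
    _ = _ :=
        integral_congr_ae (Filter.EventuallyEq.rfl.fun_mul (fourier_toLp_ae_eq hg hg2))

lemma ae_eq_zero_of_fourier_eq_zero {f : V → ℂ} (hf : Integrable f) (h : 𝓕 f = 0) :
    f =ᵐ[volume] 0 := by
  refine ae_eq_of_integral_mul_schwartz_eq hf.locallyIntegrable
    (integrable_zero V ℂ volume).locallyIntegrable fun φ _ => ?_
  calc ∫ x, f x * φ x = ∫ x, f x * 𝓕 (𝓕⁻ φ) x := by
        rw [FourierTransform.fourier_fourierInv_eq]
    _ = ∫ ξ, 𝓕 f ξ * 𝓕⁻ φ ξ := (integral_fourier_mul_of_integrable hf (𝓕⁻ φ).integrable).symm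
    _ = ∫ x, (0 : V → ℂ) x * φ x := by simp [h]

end Plancherel

/-- The inclusion `ℝ^ι → ℂ^ι`. -/
def complexify {ι : Type*} (x : EuclideanSpace ℝ ι) : ι → ℂ := fun j => x j

/-- The Gaussian `ζ ↦ exp(-w ζ·ζ + v·ζ)` as an entire function on `ℂ^ι`. -/
noncomputable def entireGaussian {ι : Type*} [Fintype ι] (w : ℂ) (v ζ : ι → ℂ) : ℂ :=
  Complex.exp (-w * (ζ ⬝ᵥ ζ) + v ⬝ᵥ ζ)

/-- The span of the entire Gaussians that decay on `ℝ^ι`: a space of test functions that is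
invariant under all the operators used below. -/
def gaussianSpan (ι : Type*) [Fintype ι] : Submodule ℂ ((ι → ℂ) → ℂ) :=
  Submodule.span ℂ {h | ∃ w v, 0 < w.re ∧ h = entireGaussian w v}

/-- The Weyl operator `exp(c·ζ + i d·∂)` on functions on `ℂ^ι`, written out by means of the
Baker–Campbell–Hausdorff formula. -/
noncomputable def weyl {ι : Type*} [Fintype ι] (c d : ι → ℂ) :
    ((ι → ℂ) → ℂ) →ₗ[ℂ] ((ι → ℂ) → ℂ) where
  toFun h ζ := Complex.exp (Complex.I * (c ⬝ᵥ d) / 2 + c ⬝ᵥ ζ) * h (ζ + Complex.I • d)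
  map_add' _ _ := funext fun _ => mul_add _ _ _
  map_smul' _ _ := funext fun _ => mul_left_comm _ _ _

section Gaussian

open Complex

variable {ι : Type*}

lemma continuous_complexify : Continuous (complexify (ι := ι)) := by
  unfold complexify; fun_prop

lemma complexify_neg (x : EuclideanSpace ℝ ι) : complexify (-x) = -complexify x := by
  ext j; simp [complexify]

variable [Fintype ι]

lemma weyl_apply (c d : ι → ℂ) (h : (ι → ℂ) → ℂ) (ζ : ι → ℂ) :
    weyl c d h ζ = exp (I * (c ⬝ᵥ d) / 2 + c ⬝ᵥ ζ) * h (ζ + I • d) := rfl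

lemma weyl_zero_zero (h : (ι → ℂ) → ℂ) : weyl 0 0 h = h := by
  ext ζ
  simp [weyl_apply]

lemma complexify_dotProduct (x y : EuclideanSpace ℝ ι) :
    complexify x ⬝ᵥ complexify y = (inner ℝ x y : ℝ) := by
  simp [complexify, dotProduct, PiLp.inner_apply, mul_comm]

lemma entireGaussian_mul (w w' : ℂ) (v v' : ι → ℂ) :
    entireGaussian w v * entireGaussian w' v' = entireGaussian (w + w') (v + v') := by
  ext ζ
  simp only [Pi.mul_apply, entireGaussian, ← exp_add, add_dotProduct]
  ring_nf

lemma weyl_entireGaussian (c d : ι → ℂ) (w : ℂ) (v : ι → ℂ) :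
    weyl c d (entireGaussian w v) =
      exp (I * (c ⬝ᵥ d) / 2 + w * (d ⬝ᵥ d) + I * (v ⬝ᵥ d)) •
        entireGaussian w (v + c - (2 * w * I) • d) := by
  ext ζ
  simp only [weyl_apply, entireGaussian, Pi.smul_apply, smul_eq_mul, ← exp_add, add_dotProduct,
    dotProduct_add, sub_dotProduct, smul_dotProduct, dotProduct_smul, dotProduct_comm ζ d]
  congr 1
  linear_combination -(w * (d ⬝ᵥ d)) * I_sq

lemma weyl_weyl (c d c' d' : ι → ℂ) (h : (ι → ℂ) → ℂ) :
    weyl c d (weyl c' d' h) = exp (I * (d ⬝ᵥ c' - c ⬝ᵥ d') / 2) • weyl (c + c') (d + d') h := by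
  ext ζ
  simp only [weyl_apply, Pi.smul_apply, smul_eq_mul, ← mul_assoc, ← exp_add, add_dotProduct,
    dotProduct_add, dotProduct_smul, smul_add, dotProduct_comm d c', add_assoc]
  congr 2
  ring

lemma entireGaussian_mem {w : ℂ} (hw : 0 < w.re) (v : ι → ℂ) :
    entireGaussian w v ∈ gaussianSpan ι := Submodule.subset_span ⟨w, v, hw, rfl⟩

lemma gaussianSpan_map_mem (T : ((ι → ℂ) → ℂ) →ₗ[ℂ] ((ι → ℂ) → ℂ))
    (hT : ∀ w v, 0 < w.re → T (entireGaussian w v) ∈ gaussianSpan ι)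
    {h : (ι → ℂ) → ℂ} (hh : h ∈ gaussianSpan ι) : T h ∈ gaussianSpan ι := by
  have hle : gaussianSpan ι ≤ (gaussianSpan ι).comap T := by
    refine Submodule.span_le.2 ?_
    rintro _ ⟨w, v, hw, rfl⟩
    exact hT w v hw
  exact hle hh

lemma weyl_mem (c d : ι → ℂ) {h : (ι → ℂ) → ℂ} (hh : h ∈ gaussianSpan ι) :
    weyl c d h ∈ gaussianSpan ι :=
  gaussianSpan_map_mem _ (fun w v hw => by
    rw [weyl_entireGaussian]
    exact Submodule.smul_mem _ _ (entireGaussian_mem hw _)) hh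

lemma entireGaussian_mul_mem {w : ℂ} (hw : 0 ≤ w.re) (v : ι → ℂ) {h : (ι → ℂ) → ℂ}
    (hh : h ∈ gaussianSpan ι) : entireGaussian w v * h ∈ gaussianSpan ι :=
  gaussianSpan_map_mem (LinearMap.mulLeft ℂ (entireGaussian w v)) (fun w' v' hw' => by
    rw [LinearMap.mulLeft_apply, entireGaussian_mul]
    exact entireGaussian_mem (add_pos_of_nonneg_of_pos hw hw') _) hh

lemma comp_neg_mem {h : (ι → ℂ) → ℂ} (hh : h ∈ gaussianSpan ι) :
    h ∘ Neg.neg ∈ gaussianSpan ι :=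
  gaussianSpan_map_mem (LinearMap.funLeft ℂ ℂ Neg.neg) (fun w v hw => by
    have hneg : LinearMap.funLeft ℂ ℂ Neg.neg (entireGaussian w v) = entireGaussian w (-v) := by
      ext ζ
      simp [LinearMap.funLeft_apply, entireGaussian]
    rw [hneg]
    exact entireGaussian_mem hw _) hh

lemma integrable_entireGaussian {w : ℂ} (hw : 0 < w.re) (v : ι → ℂ) :
    Integrable (entireGaussian w v ∘ complexify) := by
  rw [← (PiLp.volume_preserving_toLp ι).integrable_comp_emb
    (MeasurableEquiv.toLp 2 _).measurableEmbedding]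
  convert! GaussianFourier.integrable_cexp_neg_mul_sum_add hw v using 3 with y
  simp [entireGaussian, complexify, dotProduct, pow_two]

lemma integral_entireGaussian {w : ℂ} (hw : 0 < w.re) (v : ι → ℂ) :
    ∫ x, entireGaussian w v (complexify x) =
      (Real.pi / w) ^ (Fintype.card ι / 2 : ℂ) * exp ((v ⬝ᵥ v) / (4 * w)) := by
  rw [← (PiLp.volume_preserving_toLp ι).integral_comp
    (MeasurableEquiv.toLp 2 _).measurableEmbedding]
  have h := GaussianFourier.integral_cexp_neg_mul_sum_add hw v
  simpa only [entireGaussian, complexify, dotProduct, pow_two] using h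

lemma exp_inner_mul_entireGaussian (w : ℂ) (v : ι → ℂ) (x ξ : EuclideanSpace ℝ ι) :
    exp (↑(-2 * Real.pi * inner ℝ x ξ) * I) • entireGaussian w v (complexify x) =
      entireGaussian w (v + (-(2 * Real.pi * I)) • complexify ξ) (complexify x) := by
  simp only [entireGaussian, smul_eq_mul, ← exp_add, add_dotProduct, smul_dotProduct,
    complexify_dotProduct, real_inner_comm x ξ]
  push_cast
  ring_nf

lemma fourier_entireGaussian {w : ℂ} (hw : 0 < w.re) (v : ι → ℂ) :
    𝓕 (entireGaussian w v ∘ complexify) =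
      (((Real.pi / w) ^ (Fintype.card ι / 2 : ℂ) * exp ((v ⬝ᵥ v) / (4 * w))) •
        entireGaussian (Real.pi ^ 2 / w) (-(Real.pi * I / w) • v)) ∘ complexify := by
  have hw0 := ne_zero_of_re_pos hw
  ext ξ
  simp only [Real.fourier_eq', Function.comp_apply, exp_inner_mul_entireGaussian,
    integral_entireGaussian hw]
  simp only [entireGaussian, Pi.smul_apply, smul_eq_mul, add_dotProduct, dotProduct_add,
    smul_dotProduct, dotProduct_smul, dotProduct_comm (complexify ξ) v, ← exp_add,
    mul_assoc ((Real.pi / w : ℂ) ^ (Fintype.card ι / 2 : ℂ))]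
  congr 2
  field_simp
  linear_combination (4 * Real.pi ^ 2 * (complexify ξ ⬝ᵥ complexify ξ)) * I_sq

lemma continuous_entireGaussian (w : ℂ) (v : ι → ℂ) : Continuous (entireGaussian w v) := by
  unfold entireGaussian dotProduct; fun_prop

lemma memLp_entireGaussian {w : ℂ} (hw : 0 < w.re) (v : ι → ℂ) :
    MemLp (entireGaussian w v ∘ complexify) 2 := by
  refine (memLp_two_iff_integrable_sq_norm
    (integrable_entireGaussian hw v).aestronglyMeasurable).2 ?_
  refine (integrable_entireGaussian (w := w + w) (by simpa using hw) (v + v)).norm.congr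
    (.of_forall fun x => ?_)
  simp only [Function.comp_apply, ← entireGaussian_mul, Pi.mul_apply, norm_mul, pow_two]

lemma gaussianSpan_integrable {h : (ι → ℂ) → ℂ} (hh : h ∈ gaussianSpan ι) :
    Integrable (h ∘ complexify) := by
  induction hh using Submodule.span_induction with
  | mem h hh => obtain ⟨w, v, hw, rfl⟩ := hh; exact integrable_entireGaussian hw v
  | zero => exact integrable_zero _ _ _
  | add f g _ _ hf hg => exact hf.add hg
  | smul a f _ hf => exact hf.smul a

lemma gaussianSpan_memLp {h : (ι → ℂ) → ℂ} (hh : h ∈ gaussianSpan ι) :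
    MemLp (h ∘ complexify) 2 := by
  induction hh using Submodule.span_induction with
  | mem h hh => obtain ⟨w, v, hw, rfl⟩ := hh; exact memLp_entireGaussian hw v
  | zero => exact MemLp.zero
  | add f g _ _ hf hg => exact hf.add hg
  | smul a f _ hf => exact hf.const_smul a

lemma gaussianSpan_continuous {h : (ι → ℂ) → ℂ} (hh : h ∈ gaussianSpan ι) : Continuous h := by
  induction hh using Submodule.span_induction with
  | mem h hh => obtain ⟨w, v, -, rfl⟩ := hh; exact continuous_entireGaussian w v
  | zero => exact continuous_zero
  | add f g _ _ hf hg => exact hf.add hg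
  | smul a f _ hf => exact hf.const_smul a

lemma exists_fourier_eq_of_mem {h : (ι → ℂ) → ℂ} (hh : h ∈ gaussianSpan ι) :
    ∃ k ∈ gaussianSpan ι, 𝓕 (h ∘ complexify) = k ∘ complexify := by
  induction hh using Submodule.span_induction with
  | mem h hh =>
    obtain ⟨w, v, hw, rfl⟩ := hh
    have hw' : 0 < ((Real.pi : ℂ) ^ 2 / w).re := by
      have := normSq_pos.2 (ne_zero_of_re_pos hw)
      rw [← ofReal_pow, div_eq_mul_inv, re_ofReal_mul, inv_re]
      positivity
    exact ⟨_, Submodule.smul_mem _ _ (entireGaussian_mem hw' _), fourier_entireGaussian hw v⟩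
  | zero => exact ⟨0, zero_mem _, by ext ξ; simp [Real.fourier_eq']⟩
  | add f g hf hg hf' hg' =>
    obtain ⟨k, hk, hfk⟩ := hf'
    obtain ⟨l, hl, hgl⟩ := hg'
    refine ⟨k + l, add_mem hk hl, ?_⟩
    rw [Pi.add_comp, fourier_add_of_integrable (gaussianSpan_integrable hf)
      (gaussianSpan_integrable hg), hfk, hgl, Pi.add_comp]
  | smul a f _ hf' =>
    obtain ⟨k, hk, hfk⟩ := hf'
    exact ⟨a • k, Submodule.smul_mem _ _ hk, by rw [Pi.smul_comp, fourier_const_smul, hfk]; rfl⟩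

lemma exists_eq_fourier_of_mem {g : (ι → ℂ) → ℂ} (hg : g ∈ gaussianSpan ι) :
    ∃ k ∈ gaussianSpan ι, 𝓕 (k ∘ complexify) = g ∘ complexify := by
  obtain ⟨l, hl, hgl⟩ := exists_fourier_eq_of_mem hg
  have hinv : (l ∘ Neg.neg) ∘ complexify = 𝓕⁻ (g ∘ complexify) := by
    ext x
    rw [Real.fourierInv_eq_fourier_neg, hgl, Function.comp_apply, Function.comp_apply,
      Function.comp_apply, complexify_neg]
  refine ⟨_, comp_neg_mem hl, ?_⟩
  rw [hinv]
  exact ((gaussianSpan_continuous hg).comp continuous_complexify).fourier_fourierInv_eq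
    (gaussianSpan_integrable hg) (hgl ▸ gaussianSpan_integrable hl)

lemma fourier_weyl_zero_left {h : (ι → ℂ) → ℂ} (hh : h ∈ gaussianSpan ι) (d : ι → ℂ)
    (ξ : EuclideanSpace ℝ ι) :
    𝓕 (weyl 0 d h ∘ complexify) ξ =
      exp (-(2 * Real.pi) * (d ⬝ᵥ complexify ξ)) * 𝓕 (h ∘ complexify) ξ := by
  induction hh using Submodule.span_induction with
  | mem h hh =>
    obtain ⟨w, v, hw, rfl⟩ := hh
    have hw0 := ne_zero_of_re_pos hw
    rw [weyl_entireGaussian, Pi.smul_comp, fourier_const_smul, fourier_entireGaussian hw,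
      fourier_entireGaussian hw]
    simp only [entireGaussian, Function.comp_apply, Pi.smul_apply, smul_eq_mul, mul_assoc]
    rw [mul_left_comm, mul_left_comm (exp (-(2 * Real.pi) * _))]
    congr 1
    simp only [← exp_add, sub_dotProduct, dotProduct_sub, smul_dotProduct,
      dotProduct_smul, smul_eq_mul, zero_dotProduct, add_zero, dotProduct_comm d v]
    congr 1
    field_simp
    linear_combination (8 * w * (w * (d ⬝ᵥ d) + 2 * Real.pi * (d ⬝ᵥ complexify ξ))) * I_sq
  | zero => simp [Real.fourier_eq']
  | add f g hf hg hf' hg' =>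
    rw [map_add, Pi.add_comp, Pi.add_comp,
      fourier_add_of_integrable (gaussianSpan_integrable (weyl_mem _ _ hf))
        (gaussianSpan_integrable (weyl_mem _ _ hg)),
      fourier_add_of_integrable (gaussianSpan_integrable hf) (gaussianSpan_integrable hg),
      Pi.add_apply, Pi.add_apply, hf', hg', mul_add]
  | smul a f _ hf' =>
    rw [map_smul, Pi.smul_comp, Pi.smul_comp, fourier_const_smul, fourier_const_smul,
      Pi.smul_apply, Pi.smul_apply, hf', smul_eq_mul, smul_eq_mul, mul_left_comm]

end Gaussian

section Duality

variable {ι : Type*} [Fintype ι]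

lemma ae_eq_zero_of_integral_mul_entireGaussian_eq_zero {F : EuclideanSpace ℝ ι → ℂ}
    (hF : Integrable fun x => F x * entireGaussian 1 0 (complexify x))
    (h : ∀ v, ∫ x, F x * entireGaussian 1 v (complexify x) = 0) : F =ᵐ[volume] 0 := by
  have hfourier : 𝓕 (fun x => F x * entireGaussian 1 0 (complexify x)) = 0 := by
    ext ξ
    simp only [Real.fourier_eq', smul_eq_mul, mul_left_comm _ (F _)]
    simp only [← smul_eq_mul (Complex.exp _), exp_inner_mul_entireGaussian]
    exact h _
  filter_upwards [ae_eq_zero_of_fourier_eq_zero hF hfourier] with x hx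
  exact (mul_eq_zero.1 hx).resolve_right (Complex.exp_ne_zero _)

/-- The inclusion of the decaying Gaussians into `L²(ℝ^ι)`, by restriction to real arguments. -/
noncomputable def gaussianToLp :
    gaussianSpan ι →ₗ[ℂ] Lp ℂ 2 (volume : Measure (EuclideanSpace ℝ ι)) where
  toFun g := (gaussianSpan_memLp g.2).toLp _
  map_add' f g := MemLp.toLp_add (gaussianSpan_memLp f.2) (gaussianSpan_memLp g.2)
  map_smul' a g := MemLp.toLp_const_smul a (gaussianSpan_memLp g.2)

lemma gaussianToLp_ae_eq (g : gaussianSpan ι) :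
    gaussianToLp g =ᵐ[volume] g.1 ∘ complexify := (gaussianSpan_memLp g.2).coeFn_toLp

lemma integrable_Lp_mul (y : Lp ℂ 2 (volume : Measure (EuclideanSpace ℝ ι)))
    {g : (ι → ℂ) → ℂ} (hg : g ∈ gaussianSpan ι) :
    Integrable fun x => y x * g (complexify x) :=
  (Lp.memLp y).integrable_mul (gaussianSpan_memLp hg)

lemma denseRange_gaussianToLp : DenseRange (gaussianToLp (ι := ι)) := by
  rw [DenseRange, ← LinearMap.coe_range, Submodule.dense_iff_topologicalClosure_eq_top,
    Submodule.topologicalClosure_eq_top_iff, Submodule.eq_bot_iff]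
  intro y hy
  have hzero : (star y : Lp ℂ 2 (volume : Measure (EuclideanSpace ℝ ι))) =ᵐ[volume] 0 := by
    refine ae_eq_zero_of_integral_mul_entireGaussian_eq_zero
      (integrable_Lp_mul _ (entireGaussian_mem (by simp) _)) fun v => ?_
    have hg : entireGaussian 1 v ∈ gaussianSpan ι := entireGaussian_mem (by simp) v
    rw [← (Submodule.mem_orthogonal' _ y).1 hy _ ⟨⟨_, hg⟩, rfl⟩, ← integral_star_mul]
    exact integral_congr_ae (Filter.EventuallyEq.rfl.fun_mul (gaussianToLp_ae_eq ⟨_, hg⟩).symm)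
  rw [Lp.eq_zero_iff_ae_eq_zero]
  filter_upwards [hzero, Lp.coeFn_star y] with x hx hy
  simpa [hy] using hx

lemma eLpNorm_le_of_gaussianSpan {F : EuclideanSpace ℝ ι → ℂ}
    (hF : ∀ g ∈ gaussianSpan ι, Integrable fun x => F x * g (complexify x)) {M : ℝ≥0}
    (h : ∀ g ∈ gaussianSpan ι,
      ‖∫ x, F x * g (complexify x)‖ₑ ≤ M * eLpNorm (g ∘ complexify) 2) :
    eLpNorm F 2 ≤ M := by
  have hpair : ∀ (G : EuclideanSpace ℝ ι → ℂ) (g : gaussianSpan ι),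
      (fun x => G x * gaussianToLp g x) =ᵐ[volume] fun x => G x * g.1 (complexify x) :=
    fun G g => Filter.EventuallyEq.rfl.fun_mul (gaussianToLp_ae_eq g)
  obtain ⟨y, hyM, hy⟩ := exists_Lp_integral_mul_eq denseRange_gaussianToLp (F := F)
    (fun g => (hF g.1 g.2).congr (hpair F g).symm) fun g => by
      rw [integral_congr_ae (hpair F g), Lp.enorm_def, eLpNorm_congr_ae (gaussianToLp_ae_eq g)]
      exact h g.1 g.2
  have hFy : ∀ g ∈ gaussianSpan ι,
      Integrable (fun x => (F x - y x) * g (complexify x)) ∧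
        ∫ x, (F x - y x) * g (complexify x) = 0 := by
    intro g hg
    simp only [sub_mul]
    refine ⟨(hF g hg).sub (integrable_Lp_mul y hg), ?_⟩
    rw [integral_sub (hF g hg) (integrable_Lp_mul y hg), sub_eq_zero,
      ← integral_congr_ae (hpair F ⟨g, hg⟩), ← integral_congr_ae (hpair y ⟨g, hg⟩)]
    exact hy ⟨g, hg⟩
  have hmem : ∀ v, entireGaussian 1 v ∈ gaussianSpan ι := entireGaussian_mem (by simp)
  have hae : F =ᵐ[volume] y := by
    filter_upwards [ae_eq_zero_of_integral_mul_entireGaussian_eq_zero (hFy _ (hmem 0)).1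
      fun v => (hFy _ (hmem v)).2] with x hx
    exact sub_eq_zero.1 hx
  rwa [eLpNorm_congr_ae hae, ← Lp.enorm_def]

end Duality

/-- The algebra of entire functions of order at most two and finite type. -/
def entireOrderTwo : Subalgebra ℂ (ℂ → ℂ) where
  carrier := {F | Differentiable ℂ F ∧ ∃ K : ℝ, F =O[⊤] fun z => Real.exp (K * ‖z‖ ^ 2)}
  mul_mem' := by
    rintro F G ⟨hF, K, hFK⟩ ⟨hG, L, hGL⟩
    refine ⟨hF.mul hG, K + L, (hFK.mul hGL).congr_right fun z => ?_⟩
    rw [← Real.exp_add, add_mul]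
  add_mem' := by
    rintro F G ⟨hF, K, hFK⟩ ⟨hG, L, hGL⟩
    have hmono : ∀ {A B : ℝ}, A ≤ B →
        (fun z : ℂ => Real.exp (A * ‖z‖ ^ 2)) =O[⊤] fun z => Real.exp (B * ‖z‖ ^ 2) :=
      fun hAB => .of_norm_le fun z => by
        rw [Real.norm_of_nonneg (Real.exp_pos _).le]
        gcongr
    exact ⟨hF.add hG, max K L, (hFK.trans (hmono (le_max_left K L))).add
      (hGL.trans (hmono (le_max_right K L)))⟩
  algebraMap_mem' c := ⟨differentiable_const c, 0, by
    simpa using Asymptotics.isBigO_const_const c (one_ne_zero' ℝ) ⊤⟩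

section ThreeLines

open Complex

lemma exp_quadratic_mem_entireOrderTwo (a b c : ℂ) :
    (fun z => exp (a + b * z + c * z ^ 2)) ∈ entireOrderTwo := by
  refine ⟨by fun_prop, ‖b‖ + ‖c‖, .of_bound (Real.exp (‖a‖ + ‖b‖)) (.of_forall fun z => ?_)⟩
  rw [Real.norm_of_nonneg (Real.exp_pos _).le, ← Real.exp_add]
  refine (norm_exp_le_exp_norm _).trans (Real.exp_le_exp.2 ?_)
  have hz : ‖z‖ ≤ 1 + ‖z‖ ^ 2 := by nlinarith [sq_nonneg (‖z‖ - 1)]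
  calc ‖a + b * z + c * z ^ 2‖ ≤ ‖a‖ + ‖b‖ * ‖z‖ + ‖c‖ * ‖z‖ ^ 2 := by
        rw [← norm_mul, ← norm_pow, ← norm_mul]
        exact norm_add₃_le
    _ ≤ ‖a‖ + ‖b‖ * (1 + ‖z‖ ^ 2) + ‖c‖ * ‖z‖ ^ 2 := by gcongr
    _ = ‖a‖ + ‖b‖ + (‖b‖ + ‖c‖) * ‖z‖ ^ 2 := by ring

lemma norm_sq_le_one_add_im_sq {z : ℂ} (h₀ : 0 ≤ z.re) (h₁ : z.re ≤ 1) :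
    ‖z‖ ^ 2 ≤ 1 + z.im ^ 2 := by
  rw [Complex.sq_norm, normSq_apply]
  nlinarith

lemma isBigO_exp_exp_of_mem_entireOrderTwo {F : ℂ → ℂ} (hF : F ∈ entireOrderTwo) :
    ∃ B : ℝ, F =O[Filter.principal (re ⁻¹' Set.Ioo 0 1)]
      fun z => Real.exp (B * Real.exp (1 * |z.im|)) := by
  obtain ⟨-, K, hK⟩ := hF
  refine ⟨2 * |K|, (hK.mono le_top).trans
    (.of_norm_eventuallyLE (Filter.eventually_principal.2 fun z hz => ?_))⟩
  beta_reduce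
  rw [Real.norm_of_nonneg (Real.exp_pos _).le, Real.exp_le_exp, one_mul]
  have him : 1 + z.im ^ 2 ≤ 2 * Real.exp |z.im| := by
    have := Real.quadratic_le_exp_of_nonneg (abs_nonneg z.im)
    rw [sq_abs] at this
    linarith [abs_nonneg z.im]
  calc K * ‖z‖ ^ 2 ≤ |K| * (1 + z.im ^ 2) := by
        gcongr
        · exact le_abs_self K
        · exact norm_sq_le_one_add_im_sq hz.1.le hz.2.le
    _ ≤ |K| * (2 * Real.exp |z.im|) := by gcongr
    _ = 2 * |K| * Real.exp |z.im| := by ring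

lemma norm_le_rpow_mul_rpow_of_mem_entireOrderTwo {F : ℂ → ℂ} (hF : F ∈ entireOrderTwo)
    {a b : ℝ} (ha : ∀ z : ℂ, z.re = 0 → ‖F z‖ ≤ a) (hb : ∀ z : ℂ, z.re = 1 → ‖F z‖ ≤ b)
    {θ : ℝ} (hθ₀ : 0 ≤ θ) (hθ₁ : θ ≤ 1) : ‖F θ‖ ≤ a ^ (1 - θ) * b ^ θ := by
  obtain ⟨B, hB⟩ := isBigO_exp_exp_of_mem_entireOrderTwo hF
  have hbdd : ∀ z : ℂ, 0 ≤ z.re → z.re ≤ 1 → ‖F z‖ ≤ max a b := fun z =>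
    PhragmenLindelof.vertical_strip hF.1.diffContOnCl
      ⟨1, by linarith [Real.pi_gt_three], B, hB.mono inf_le_right⟩
      (fun z hz => (ha z hz).trans (le_max_left a b))
      (fun z hz => (hb z hz).trans (le_max_right a b))
  have hmax : BddAbove ((norm ∘ F) '' HadamardThreeLines.verticalClosedStrip 0 1) :=
    ⟨max a b, Set.forall_mem_image.2 fun z hz => hbdd z hz.1 hz.2⟩
  simpa only [ofReal_re] using
    HadamardThreeLines.norm_le_interp_of_mem_verticalClosedStrip₀₁' F (z := θ)
      ⟨by simpa using hθ₀, by simpa using hθ₁⟩ hF.1.diffContOnCl hmax ha hb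

section ExponentialIntegral

variable {X : Type*} [MeasurableSpace X] {ν : Measure X} {f L : X → ℂ}

lemma norm_mul_exp_mul_le {R : ℝ} {z : ℂ} (hz : ‖z‖ ≤ R) (a l : ℂ) :
    ‖a * exp (z * l)‖ ≤ ‖a‖ * Real.exp (R * ‖l‖) := by
  rw [norm_mul]
  gcongr
  refine (norm_exp_le_exp_norm _).trans (Real.exp_le_exp.2 ?_)
  rw [norm_mul]
  gcongr

lemma differentiable_integral_mul_exp (hf : AEStronglyMeasurable f ν)
    (hL : AEStronglyMeasurable L ν)
    (h : ∀ R : ℝ, Integrable (fun x => ‖f x‖ * Real.exp (R * ‖L x‖)) ν) :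
    Differentiable ℂ fun z : ℂ => ∫ x, f x * exp (z * L x) ∂ν := by
  intro z₀
  have hmeas : ∀ z : ℂ, AEStronglyMeasurable (fun x => f x * exp (z * L x)) ν :=
    fun z => hf.mul (continuous_exp.comp_aestronglyMeasurable (hL.const_mul z))
  have hderiv : ∀ x z, z ∈ Metric.ball z₀ 1 →
      ‖f x * exp (z * L x) * L x‖ ≤ ‖f x‖ * Real.exp ((‖z₀‖ + 2) * ‖L x‖) := by
    intro x z hz
    have hz' : ‖z‖ ≤ ‖z₀‖ + 1 := by
      linarith [norm_le_norm_add_norm_sub' z z₀, mem_ball_iff_norm.1 hz]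
    calc ‖f x * exp (z * L x) * L x‖
        ≤ ‖f x‖ * Real.exp ((‖z₀‖ + 1) * ‖L x‖) * Real.exp ‖L x‖ := by
          rw [norm_mul]
          gcongr
          · exact norm_mul_exp_mul_le hz' _ _
          · linarith [Real.add_one_le_exp ‖L x‖]
      _ = ‖f x‖ * Real.exp ((‖z₀‖ + 2) * ‖L x‖) := by
          rw [mul_assoc, ← Real.exp_add]
          ring_nf
  refine (hasDerivAt_integral_of_dominated_loc_of_deriv_le
    (Metric.ball_mem_nhds z₀ zero_lt_one) (.of_forall hmeas)
    ((h ‖z₀‖).mono' (hmeas z₀) (.of_forall fun x => norm_mul_exp_mul_le le_rfl _ _))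
    ((hmeas z₀).mul hL) (.of_forall hderiv) (h _)
    (.of_forall fun x z _ => ?_)).2.differentiableAt
  exact (((hasDerivAt_id z).mul_const (L x)).cexp.const_mul (f x)).congr_deriv
    (by simp [mul_assoc])

lemma integral_mul_exp_mem_entireOrderTwo {g : X → ℝ} {K : ℝ}
    (hf : AEStronglyMeasurable f ν) (hL : AEStronglyMeasurable L ν) (hg : Integrable g ν)
    (h : ∀ R x, ‖f x‖ * Real.exp (R * ‖L x‖) ≤ Real.exp (K * R ^ 2) * g x) :
    (fun z : ℂ => ∫ x, f x * exp (z * L x) ∂ν) ∈ entireOrderTwo := by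
  refine ⟨differentiable_integral_mul_exp hf hL fun R => ?_,
    K, .of_bound (∫ x, g x ∂ν) (.of_forall fun z => ?_)⟩
  · refine (hg.const_mul (Real.exp (K * R ^ 2))).mono' (hf.norm.mul ?_) (.of_forall fun x => ?_)
    · exact Real.continuous_exp.comp_aestronglyMeasurable (hL.norm.const_mul R)
    · rw [Real.norm_of_nonneg (by positivity)]
      exact h R x
  · rw [Real.norm_of_nonneg (Real.exp_pos _).le, mul_comm, ← integral_const_mul]
    exact norm_integral_le_of_norm_le (hg.const_mul _)
      (.of_forall fun x => (norm_mul_exp_mul_le le_rfl _ _).trans (h _ x))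

end ExponentialIntegral

variable {ι : Type*} [Fintype ι]

lemma norm_dotProduct_complexify_le (b : ι → ℂ) (x : EuclideanSpace ℝ ι) :
    ‖b ⬝ᵥ complexify x‖ ≤ (∑ j, ‖b j‖) * ‖x‖ := by
  rw [dotProduct, Finset.sum_mul]
  refine (norm_sum_le _ _).trans (Finset.sum_le_sum fun j _ => ?_)
  rw [norm_mul, complexify, norm_real]
  gcongr
  exact PiLp.norm_apply_le x j

lemma norm_entireGaussian (w : ℂ) (v : ι → ℂ) (x : EuclideanSpace ℝ ι) :
    ‖entireGaussian w v (complexify x)‖ =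
      Real.exp (-w.re * ‖x‖ ^ 2 + (v ⬝ᵥ complexify x).re) := by
  rw [entireGaussian, norm_exp, complexify_dotProduct, real_inner_self_eq_norm_sq, add_re,
    re_mul_ofReal, neg_re]

lemma norm_entireGaussian_mul_exp_le {w : ℂ} (hw : 0 < w.re) (v b : ι → ℂ) :
    ∃ K : ℝ, ∀ (R : ℝ) (x : EuclideanSpace ℝ ι),
      ‖entireGaussian w v (complexify x)‖ * Real.exp (R * ‖b ⬝ᵥ complexify x‖) ≤
        Real.exp (K * R ^ 2) * ‖entireGaussian (w / 2) v (complexify x)‖ := by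
  set B : ℝ := ∑ j, ‖b j‖
  refine ⟨B ^ 2 / (2 * w.re), fun R x => ?_⟩
  have hlinear : R * ‖b ⬝ᵥ complexify x‖ ≤ |R| * (B * ‖x‖) :=
    mul_le_mul (le_abs_self R) (norm_dotProduct_complexify_le b x) (norm_nonneg _) (abs_nonneg R)
  have hsquare : B ^ 2 / (2 * w.re) * R ^ 2 + w.re / 2 * ‖x‖ ^ 2 - |R| * (B * ‖x‖) =
      (B * |R| - w.re * ‖x‖) ^ 2 / (2 * w.re) := by
    field_simp
    rw [← sq_abs R]
    ring
  have hnonneg : 0 ≤ (B * |R| - w.re * ‖x‖) ^ 2 / (2 * w.re) := by positivity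
  have hhalf : (w / 2).re = w.re / 2 := by simp
  rw [norm_entireGaussian, norm_entireGaussian, ← Real.exp_add, ← Real.exp_add, Real.exp_le_exp,
    hhalf]
  linarith

end ThreeLines

/-- The bilinear pairing of `v` with `exp(c·X + i d·∂) h`. -/
noncomputable def weylPairing {ι : Type*} [Fintype ι]
    (v : Lp ℂ 2 (volume : Measure (EuclideanSpace ℝ ι))) (c d : ι → ℂ) (h : (ι → ℂ) → ℂ) : ℂ :=
  ∫ x, v x * weyl c d h (complexify x)

/-- The norm `‖exp(c·X - i d·∂) v‖_{L²}` in `[0, ∞]`, by duality against `gaussianSpan`; the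
operator is the transpose of `weyl c d`. -/
noncomputable def weylNorm {ι : Type*} [Fintype ι]
    (v : Lp ℂ 2 (volume : Measure (EuclideanSpace ℝ ι))) (c d : EuclideanSpace ℝ ι) : ℝ≥0∞ :=
  ⨆ h ∈ gaussianSpan ι,
    ‖weylPairing v (complexify c) (complexify d) h‖ₑ / eLpNorm (h ∘ complexify) 2

section WeylNorm

open Complex

variable {ι : Type*} [Fintype ι] {v : Lp ℂ 2 (volume : Measure (EuclideanSpace ℝ ι))}

lemma weylPairing_add (c d : ι → ℂ) {g h : (ι → ℂ) → ℂ} (hg : g ∈ gaussianSpan ι)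
    (hh : h ∈ gaussianSpan ι) :
    weylPairing v c d (g + h) = weylPairing v c d g + weylPairing v c d h := by
  rw [weylPairing, weylPairing, weylPairing, map_add, ← integral_add
    (integrable_Lp_mul v (weyl_mem c d hg)) (integrable_Lp_mul v (weyl_mem c d hh))]
  simp only [Pi.add_apply, mul_add]

lemma weylPairing_smul (c d : ι → ℂ) (a : ℂ) (h : (ι → ℂ) → ℂ) :
    weylPairing v c d (a • h) = a * weylPairing v c d h := by
  simp only [weylPairing, map_smul, Pi.smul_apply, smul_eq_mul, mul_left_comm _ a,
    integral_const_mul]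

lemma weylPairing_weyl (c d c' d' : ι → ℂ) (h : (ι → ℂ) → ℂ) :
    weylPairing v c d (weyl c' d' h) =
      exp (I * (d ⬝ᵥ c' - c ⬝ᵥ d') / 2) * weylPairing v (c + c') (d + d') h := by
  simp only [weylPairing, weyl_weyl, Pi.smul_apply, smul_eq_mul, mul_left_comm _ (exp _),
    integral_const_mul]

lemma weylPairing_entireGaussian_add_smul (c₀ c₁ d₀ d₁ : ι → ℂ) (w : ℂ) (u : ι → ℂ) (z : ℂ) :
    weylPairing v (c₀ + z • c₁) (d₀ + z • d₁) (entireGaussian w u) =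
      exp (I * (c₀ ⬝ᵥ d₀) / 2 + w * (d₀ ⬝ᵥ d₀) + I * (u ⬝ᵥ d₀) +
        (I * (c₀ ⬝ᵥ d₁ + c₁ ⬝ᵥ d₀) / 2 + 2 * w * (d₀ ⬝ᵥ d₁) + I * (u ⬝ᵥ d₁)) * z +
        (I * (c₁ ⬝ᵥ d₁) / 2 + w * (d₁ ⬝ᵥ d₁)) * z ^ 2) *
      ∫ x, v x * entireGaussian w (u + c₀ - (2 * w * I) • d₀) (complexify x) *
        exp (z * ((c₁ - (2 * w * I) • d₁) ⬝ᵥ complexify x)) := by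
  rw [weylPairing, ← integral_const_mul]
  refine integral_congr_ae (.of_forall fun x => ?_)
  simp only [weyl_entireGaussian, Pi.smul_apply, smul_eq_mul]
  rw [mul_assoc (v x), mul_left_comm _ (v x)]
  congr 1
  simp only [entireGaussian, ← exp_add, add_dotProduct, dotProduct_add, sub_dotProduct,
    smul_dotProduct, dotProduct_smul, smul_eq_mul, dotProduct_comm d₁ d₀]
  congr 1
  ring

lemma weylPairing_mem_entireOrderTwo (c₀ c₁ d₀ d₁ : ι → ℂ) {h : (ι → ℂ) → ℂ}
    (hh : h ∈ gaussianSpan ι) :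
    (fun z : ℂ => weylPairing v (c₀ + z • c₁) (d₀ + z • d₁) h) ∈ entireOrderTwo := by
  induction hh using Submodule.span_induction with
  | mem h hh =>
    obtain ⟨w, u, hw, rfl⟩ := hh
    simp only [weylPairing_entireGaussian_add_smul]
    refine mul_mem (exp_quadratic_mem_entireOrderTwo _ _ _) ?_
    obtain ⟨K, hK⟩ := norm_entireGaussian_mul_exp_le hw (u + c₀ - (2 * w * I) • d₀)
      (c₁ - (2 * w * I) • d₁)
    have hhalf : 0 < (w / 2).re := by simpa using hw
    refine integral_mul_exp_mem_entireOrderTwo (K := K)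
      (integrable_Lp_mul v (entireGaussian_mem hw _)).aestronglyMeasurable
      (by unfold dotProduct complexify; fun_prop)
      (integrable_Lp_mul v (entireGaussian_mem hhalf (u + c₀ - (2 * w * I) • d₀))).norm
      fun R x => ?_
    rw [norm_mul, norm_mul, mul_assoc, mul_left_comm (Real.exp _)]
    exact mul_le_mul_of_nonneg_left (hK R x) (norm_nonneg _)
  | zero =>
    simp only [weylPairing, map_zero, Pi.zero_apply, mul_zero, integral_zero]
    exact zero_mem entireOrderTwo
  | add f g hf hg hf' hg' =>
    simp only [weylPairing_add _ _ hf hg]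
    exact add_mem hf' hg'
  | smul a f _ hf' =>
    simp only [weylPairing_smul]
    exact Subalgebra.smul_mem _ hf' a

lemma weylNorm_le_iff {c d : EuclideanSpace ℝ ι} {M : ℝ≥0∞} (hM : M ≠ ⊤) :
    weylNorm v c d ≤ M ↔ ∀ h ∈ gaussianSpan ι,
      ‖weylPairing v (complexify c) (complexify d) h‖ₑ ≤ M * eLpNorm (h ∘ complexify) 2 := by
  simp only [weylNorm, iSup_le_iff]
  exact forall₂_congr fun h hh =>
    ENNReal.div_le_iff_le_mul (.inr hM) (.inl (gaussianSpan_memLp hh).2.ne)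

lemma weylNorm_eq_zero_iff {c d : EuclideanSpace ℝ ι} : weylNorm v c d = 0 ↔ v = 0 := by
  constructor
  · intro h
    have hpair : ∀ g ∈ gaussianSpan ι, ∫ x, v x * g (complexify x) = 0 := by
      intro g hg
      have hinv := (weylNorm_le_iff ENNReal.zero_ne_top).1 h.le _
        (weyl_mem (-complexify c) (-complexify d) hg)
      rw [zero_mul, nonpos_iff_eq_zero, enorm_eq_zero, weylPairing_weyl, add_neg_cancel,
        add_neg_cancel] at hinv
      simpa [weylPairing, weyl_zero_zero] using hinv
    have hnorm : eLpNorm v 2 ≤ (0 : ℝ≥0) :=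
      eLpNorm_le_of_gaussianSpan (fun g => integrable_Lp_mul v) fun g hg => by simp [hpair g hg]
    rwa [ENNReal.coe_zero, nonpos_iff_eq_zero, ← Lp.enorm_def, enorm_eq_zero] at hnorm
  · rintro rfl
    have hpair : ∀ h, weylPairing (0 : Lp ℂ 2 (volume : Measure (EuclideanSpace ℝ ι)))
        (complexify c) (complexify d) h = 0 := fun h => by
      refine integral_eq_zero_of_ae ?_
      filter_upwards [Lp.coeFn_zero ℂ 2 volume] with x hx
      rw [hx, Pi.zero_apply, zero_mul]
    simp [weylNorm, hpair]

lemma eLpNorm_weyl_imaginary (c d : EuclideanSpace ℝ ι) (η : ℝ) {h : (ι → ℂ) → ℂ}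
    (hh : h ∈ gaussianSpan ι) :
    eLpNorm (weyl ((η * I) • complexify c) ((η * I) • complexify d) h ∘ complexify) 2 =
      eLpNorm (h ∘ complexify) 2 := by
  rw [← eLpNorm_comp_measurePreserving (gaussianSpan_memLp hh).1
    (measurePreserving_sub_right (volume : Measure (EuclideanSpace ℝ ι)) (η • d))]
  refine eLpNorm_congr_norm_ae (.of_forall fun x => ?_)
  have hshift : complexify x + I • (η * I) • complexify d = complexify (x - η • d) := by
    ext j
    simp only [complexify, Pi.add_apply, Pi.smul_apply, smul_eq_mul, PiLp.sub_apply,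
      PiLp.smul_apply, ofReal_sub, ofReal_mul]
    linear_combination (η * d j : ℂ) * I_sq
  have hphase : I * ((η * I) • complexify c ⬝ᵥ (η * I) • complexify d) / 2 +
      (η * I) • complexify c ⬝ᵥ complexify x =
        ((-η * η * inner ℝ c d / 2 + η * inner ℝ c x : ℝ) : ℂ) * I := by
    simp only [smul_dotProduct, dotProduct_smul, complexify_dotProduct, smul_eq_mul]
    push_cast
    linear_combination (η * η * inner ℝ c d / 2 * I : ℂ) * I_sq
  simp only [Function.comp_apply, weyl_apply, norm_mul, hshift, hphase, norm_exp_ofReal_mul_I,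
    one_mul]

/-- The exponential prefactor has the modulus of the Weyl commutation factor, so the imaginary part
of `z` only contributes an isometry. -/
lemma norm_weylPairing_add_smul (c₀ c₁ d₀ d₁ : EuclideanSpace ℝ ι) (h : (ι → ℂ) → ℂ) (z : ℂ) :
    ‖exp (I * (inner ℝ d₀ c₁ - inner ℝ c₀ d₁ : ℝ) / 2 * z) *
        weylPairing v (complexify c₀ + z • complexify c₁) (complexify d₀ + z • complexify d₁) h‖ =
      ‖weylPairing v (complexify (c₀ + z.re • c₁)) (complexify (d₀ + z.re • d₁))
        (weyl ((z.im * I) • complexify c₁) ((z.im * I) • complexify d₁) h)‖ := by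
  have hsum : ∀ a b : EuclideanSpace ℝ ι,
      complexify (a + z.re • b) + (z.im * I) • complexify b = complexify a + z • complexify b := by
    intro a b
    ext j
    simp only [complexify, Pi.add_apply, Pi.smul_apply, smul_eq_mul, PiLp.add_apply,
      PiLp.smul_apply, ofReal_add, ofReal_mul]
    linear_combination (b j : ℂ) * re_add_im z
  have hphase : I * (complexify (d₀ + z.re • d₁) ⬝ᵥ (z.im * I) • complexify c₁ -
      complexify (c₀ + z.re • c₁) ⬝ᵥ (z.im * I) • complexify d₁) / 2 =
        (-(z.im * (inner ℝ d₀ c₁ - inner ℝ c₀ d₁) / 2) : ℝ) := by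
    simp only [dotProduct_smul, complexify_dotProduct, inner_add_left, real_inner_smul_left,
      smul_eq_mul, real_inner_comm d₁ c₁]
    push_cast
    linear_combination (z.im * (inner ℝ d₀ c₁ - inner ℝ c₀ d₁) / 2 : ℂ) * I_sq
  rw [weylPairing_weyl, hsum, hsum, hphase, norm_mul, norm_mul, norm_exp, norm_exp, ofReal_re]
  congr 2
  simp [mul_comm, mul_div_assoc]

lemma enorm_weylPairing_le {c₀ c₁ d₀ d₁ : EuclideanSpace ℝ ι} (h₀ : weylNorm v c₀ d₀ ≠ ⊤)
    (h₁ : weylNorm v (c₀ + c₁) (d₀ + d₁) ≠ ⊤) {θ : ℝ} (hθ₀ : 0 ≤ θ) (hθ₁ : θ ≤ 1)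
    {h : (ι → ℂ) → ℂ} (hh : h ∈ gaussianSpan ι) :
    ‖weylPairing v (complexify (c₀ + θ • c₁)) (complexify (d₀ + θ • d₁)) h‖ₑ ≤
      (weylNorm v c₀ d₀ * eLpNorm (h ∘ complexify) 2) ^ (1 - θ) *
        (weylNorm v (c₀ + c₁) (d₀ + d₁) * eLpNorm (h ∘ complexify) 2) ^ θ := by
  set F : ℂ → ℂ := fun z => exp (I * (inner ℝ d₀ c₁ - inner ℝ c₀ d₁ : ℝ) / 2 * z) *
    weylPairing v (complexify c₀ + z • complexify c₁) (complexify d₀ + z • complexify d₁) h with hF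
  have hexp := exp_quadratic_mem_entireOrderTwo 0 (I * (inner ℝ d₀ c₁ - inner ℝ c₀ d₁ : ℝ) / 2) 0
  simp only [zero_add, zero_mul, add_zero] at hexp
  have hFmem : F ∈ entireOrderTwo := mul_mem hexp (weylPairing_mem_entireOrderTwo _ _ _ _ hh)
  have hline : ∀ z : ℂ, weylNorm v (c₀ + z.re • c₁) (d₀ + z.re • d₁) ≠ ⊤ →
      ‖F z‖ ≤ (weylNorm v (c₀ + z.re • c₁) (d₀ + z.re • d₁) *
        eLpNorm (h ∘ complexify) 2).toReal := by
    intro z hz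
    rw [hF, norm_weylPairing_add_smul, ← toReal_enorm, ← eLpNorm_weyl_imaginary c₁ d₁ z.im hh]
    have hmem := weyl_mem ((z.im * I) • complexify c₁) ((z.im * I) • complexify d₁) hh
    exact ENNReal.toReal_mono (ENNReal.mul_ne_top hz (gaussianSpan_memLp hmem).2.ne)
      ((weylNorm_le_iff hz).1 le_rfl _ hmem)
  have hthree := norm_le_rpow_mul_rpow_of_mem_entireOrderTwo hFmem
    (a := (weylNorm v c₀ d₀ * eLpNorm (h ∘ complexify) 2).toReal)
    (b := (weylNorm v (c₀ + c₁) (d₀ + d₁) * eLpNorm (h ∘ complexify) 2).toReal)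
    (fun z hz => by simpa [hz, h₀] using hline z)
    (fun z hz => by simpa [hz, h₁] using hline z) hθ₀ hθ₁
  have hFθ : ‖F θ‖ = ‖weylPairing v (complexify (c₀ + θ • c₁)) (complexify (d₀ + θ • d₁)) h‖ := by
    rw [hF, norm_weylPairing_add_smul]
    simp [weyl_zero_zero]
  have hN := (gaussianSpan_memLp hh).2.ne
  have htop : ∀ {W : ℝ≥0∞} {r : ℝ}, W ≠ ⊤ → 0 ≤ r →
      (W * eLpNorm (h ∘ complexify) 2) ^ r ≠ ⊤ :=
    fun hW hr => ENNReal.rpow_ne_top_of_nonneg hr (ENNReal.mul_ne_top hW hN)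
  rwa [ENNReal.toReal_rpow, ENNReal.toReal_rpow, ← ENNReal.toReal_mul, hFθ, ← toReal_enorm,
    ENNReal.toReal_le_toReal enorm_ne_top
      (ENNReal.mul_ne_top (htop h₀ (sub_nonneg.2 hθ₁)) (htop h₁ hθ₀))] at hthree

theorem weylNorm_le_rpow_mul_rpow (v : Lp ℂ 2 (volume : Measure (EuclideanSpace ℝ ι)))
    (c₀ c₁ d₀ d₁ : EuclideanSpace ℝ ι) {θ : ℝ} (hθ₀ : 0 ≤ θ) (hθ₁ : θ ≤ 1) :
    weylNorm v ((1 - θ) • c₀ + θ • c₁) ((1 - θ) • d₀ + θ • d₁) ≤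
      weylNorm v c₀ d₀ ^ (1 - θ) * weylNorm v c₁ d₁ ^ θ := by
  rcases eq_or_ne v 0 with rfl | hv
  · rw [weylNorm_eq_zero_iff.2 rfl]
    exact zero_le
  rcases hθ₀.eq_or_lt with rfl | hθ₀'
  · simp
  rcases hθ₁.eq_or_lt with rfl | hθ₁'
  · simp
  have hpos : ∀ {c d : EuclideanSpace ℝ ι} {r : ℝ}, 0 < r → weylNorm v c d ^ r ≠ 0 :=
    fun hr => by simp [ENNReal.rpow_eq_zero_iff, weylNorm_eq_zero_iff, hv, hr.not_gt]
  have hθ' : 0 < 1 - θ := sub_pos.2 hθ₁'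
  by_cases h₀ : weylNorm v c₀ d₀ = ⊤
  · rw [h₀, ENNReal.top_rpow_of_pos hθ', ENNReal.top_mul (hpos hθ₀')]
    exact le_top
  by_cases h₁ : weylNorm v c₁ d₁ = ⊤
  · rw [h₁, ENNReal.top_rpow_of_pos hθ₀', ENNReal.mul_top (hpos hθ')]
    exact le_top
  have hline : ∀ a b : EuclideanSpace ℝ ι, (1 - θ) • a + θ • b = a + θ • (b - a) := by
    intro a b
    module
  rw [hline, hline, weylNorm_le_iff (ENNReal.mul_ne_top
    (ENNReal.rpow_ne_top_of_nonneg hθ'.le h₀) (ENNReal.rpow_ne_top_of_nonneg hθ₀ h₁))]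
  intro h hh
  have hadd : ∀ a b : EuclideanSpace ℝ ι, a + (b - a) = b := add_sub_cancel
  refine (enorm_weylPairing_le h₀ (by rwa [hadd, hadd]) hθ₀ hθ₁ hh).trans_eq ?_
  rw [hadd, hadd, ENNReal.mul_rpow_of_nonneg _ _ hθ'.le, ENNReal.mul_rpow_of_nonneg _ _ hθ₀,
    mul_mul_mul_comm, ← ENNReal.rpow_add_of_nonneg _ _ hθ'.le hθ₀, sub_add_cancel,
    ENNReal.rpow_one]

end WeylNorm

/-- The weighted norm `‖exp(s·x) f‖_{L²}`, with values in `[0, ∞]`. -/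
noncomputable def exponentialNorm {ι : Type*} [Fintype ι] (s : EuclideanSpace ℝ ι)
    (f : EuclideanSpace ℝ ι → ℂ) : ℝ≥0∞ :=
  eLpNorm (fun x => (Real.exp (inner ℝ s x) : ℂ) * f x) 2

/-- The Fourier multiplier `exp(-4π² i t |η|²)` of the free Schrödinger group `exp(itΔ)`. -/
noncomputable def schrodingerPhase {V : Type*} [Norm V] (t : ℝ) (η : V) : ℂ :=
  Complex.exp ((-(4 * Real.pi ^ 2 * t * ‖η‖ ^ 2) : ℝ) * Complex.I)

/-- `g = exp(itΔ) f`, expressed on the Fourier side. -/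
def IsFreeEvolution {ι : Type*} [Fintype ι] (f : Lp ℂ 2 (volume : Measure (EuclideanSpace ℝ ι)))
    (t : ℝ) (g : Lp ℂ 2 (volume : Measure (EuclideanSpace ℝ ι))) : Prop :=
  (𝓕 g : Lp ℂ 2 volume) =ᵐ[volume] fun η => schrodingerPhase t η * (𝓕 f : Lp ℂ 2 volume) η

section ExponentialWeight

open Complex

variable {ι : Type*} [Fintype ι] {f g : Lp ℂ 2 (volume : Measure (EuclideanSpace ℝ ι))} {t : ℝ}

lemma aestronglyMeasurable_exp_inner_mul (s : EuclideanSpace ℝ ι)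
    {f : EuclideanSpace ℝ ι → ℂ} (hf : AEStronglyMeasurable f) :
    AEStronglyMeasurable fun x => (Real.exp (inner ℝ s x) : ℂ) * f x :=
  (by fun_prop : Continuous fun x => (Real.exp (inner ℝ s x) : ℂ)).aestronglyMeasurable.mul hf

lemma norm_schrodingerPhase {V : Type*} [Norm V] (t : ℝ) (η : V) : ‖schrodingerPhase t η‖ = 1 :=
  norm_exp_ofReal_mul_I _

lemma schrodingerPhase_eq_entireGaussian (t : ℝ) (η : EuclideanSpace ℝ ι) :
    schrodingerPhase t η = entireGaussian ((4 * Real.pi ^ 2 * t : ℝ) * I) 0 (complexify η) := by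
  rw [schrodingerPhase, entireGaussian, complexify_dotProduct, real_inner_self_eq_norm_sq,
    zero_dotProduct]
  push_cast
  ring_nf

/-- Conjugation by a quadratic phase acts on the Weyl operators by a linear change of their
parameters. -/
lemma weyl_entireGaussian_mul (w : ℂ) (c d : ι → ℂ) (k : (ι → ℂ) → ℂ) :
    weyl c d (entireGaussian w 0 * k) =
      entireGaussian w 0 * weyl (c - (2 * w * I) • d) d k := by
  ext ζ
  simp only [weyl_apply, Pi.mul_apply, entireGaussian, ← mul_assoc, ← exp_add, zero_dotProduct,
    add_dotProduct, sub_dotProduct, dotProduct_add, smul_dotProduct, dotProduct_smul, smul_eq_mul,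
    dotProduct_comm ζ d]
  congr 2
  ring

lemma weyl_schrodinger (t : ℝ) (s : EuclideanSpace ℝ ι) (k : (ι → ℂ) → ℂ)
    (η : EuclideanSpace ℝ ι) :
    weyl (complexify ((4 * Real.pi * t) • s)) (complexify (-(2 * Real.pi)⁻¹ • s))
        (entireGaussian ((4 * Real.pi ^ 2 * t : ℝ) * I) 0 * k) (complexify η) =
      schrodingerPhase t η * weyl 0 (complexify (-(2 * Real.pi)⁻¹ • s)) k (complexify η) := by
  have hzero : complexify ((4 * Real.pi * t) • s) -
      (2 * ((4 * Real.pi ^ 2 * t : ℝ) * I) * I) • complexify (-(2 * Real.pi)⁻¹ • s) = 0 := by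
    ext j
    simp only [complexify, Pi.sub_apply, Pi.smul_apply, smul_eq_mul, PiLp.smul_apply, Pi.zero_apply]
    push_cast
    field_simp
    linear_combination (4 * Real.pi * t * s j : ℂ) * I_sq
  rw [weyl_entireGaussian_mul, hzero, Pi.mul_apply, schrodingerPhase_eq_entireGaussian]

lemma weylPairing_fourier (hg : IsFreeEvolution f t g) (s : EuclideanSpace ℝ ι)
    {k : (ι → ℂ) → ℂ} (hk : k ∈ gaussianSpan ι) :
    weylPairing (𝓕 f) (complexify ((4 * Real.pi * t) • s)) (complexify (-(2 * Real.pi)⁻¹ • s))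
        (entireGaussian ((4 * Real.pi ^ 2 * t : ℝ) * I) 0 * k) =
      ∫ x, (Real.exp (inner ℝ s x) * g x) * 𝓕 (k ∘ complexify) x := by
  set d := complexify (-(2 * Real.pi)⁻¹ • s) with hd
  have hmem := weyl_mem 0 d hk
  have hexp : ∀ x : EuclideanSpace ℝ ι,
      -(2 * Real.pi) * (d ⬝ᵥ complexify x) = (inner ℝ s x : ℝ) := by
    intro x
    rw [hd, complexify_dotProduct, real_inner_smul_left]
    push_cast
    field_simp
  calc _ = ∫ η, (𝓕 g : Lp ℂ 2 volume) η * weyl 0 d k (complexify η) := by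
        refine integral_congr_ae ?_
        filter_upwards [hg] with η hη
        rw [hη, hd, weyl_schrodinger]
        ring
    _ = ∫ x, g x * 𝓕 (weyl 0 d k ∘ complexify) x :=
        integral_Lp_fourier_mul_eq g (gaussianSpan_integrable hmem) (gaussianSpan_memLp hmem)
    _ = _ := by
        refine integral_congr_ae (.of_forall fun x => ?_)
        simp only [fourier_weyl_zero_left hk, hexp, ofReal_exp]
        ring

lemma eLpNorm_entireGaussian_imaginary_mul (a : ℝ) (k : (ι → ℂ) → ℂ) :
    eLpNorm ((entireGaussian (a * I) 0 * k) ∘ complexify) 2 = eLpNorm (k ∘ complexify) 2 := by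
  refine eLpNorm_congr_norm_ae (.of_forall fun x => ?_)
  simp [norm_entireGaussian]

lemma weylNorm_le_exponentialNorm (hg : IsFreeEvolution f t g) (s : EuclideanSpace ℝ ι) :
    weylNorm (𝓕 f) ((4 * Real.pi * t) • s) (-(2 * Real.pi)⁻¹ • s) ≤ exponentialNorm s g := by
  rcases eq_or_ne (exponentialNorm s g) ⊤ with htop | htop
  · exact htop ▸ le_top
  refine (weylNorm_le_iff htop).2 fun h hh => ?_
  set a : ℝ := 4 * Real.pi ^ 2 * t
  have hinv : h = entireGaussian (a * I) 0 * (entireGaussian ((-a : ℝ) * I) 0 * h) := by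
    ext ζ
    simp [← mul_assoc, entireGaussian, ← Complex.exp_add]
  have hk : entireGaussian ((-a : ℝ) * I) 0 * h ∈ gaussianSpan ι :=
    entireGaussian_mul_mem (by simp) 0 hh
  obtain ⟨l, hl, hkl⟩ := exists_fourier_eq_of_mem hk
  rw [← eLpNorm_entireGaussian_imaginary_mul (-a), ← eLpNorm_fourier_eq
    (gaussianSpan_integrable hk) (gaussianSpan_memLp hk)]
  nth_rewrite 1 [hinv]
  rw [weylPairing_fourier hg s hk, hkl]
  exact enorm_integral_mul_le (aestronglyMeasurable_exp_inner_mul s (Lp.aestronglyMeasurable g))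
    (gaussianSpan_memLp hl).1

lemma exponentialNorm_le_weylNorm (hg : IsFreeEvolution f t g) (s : EuclideanSpace ℝ ι) :
    exponentialNorm s g ≤ weylNorm (𝓕 f) ((4 * Real.pi * t) • s) (-(2 * Real.pi)⁻¹ • s) := by
  rcases eq_or_ne (weylNorm (𝓕 f) ((4 * Real.pi * t) • s) (-(2 * Real.pi)⁻¹ • s)) ⊤ with htop | htop
  · exact htop ▸ le_top
  rw [← ENNReal.coe_toNNReal htop]
  refine eLpNorm_le_of_gaussianSpan (fun h hh => ?_) fun h hh => ?_
  · refine (integrable_Lp_mul g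
      (entireGaussian_mul_mem (w := 0) le_rfl (complexify s) hh)).congr (.of_forall fun x => ?_)
    simp only [Pi.mul_apply, entireGaussian, neg_zero, zero_mul, zero_add, complexify_dotProduct,
      ofReal_exp]
    ring
  · obtain ⟨k, hk, hkh⟩ := exists_eq_fourier_of_mem hh
    have hmem : entireGaussian ((4 * Real.pi ^ 2 * t : ℝ) * I) 0 * k ∈ gaussianSpan ι :=
      entireGaussian_mul_mem (by rw [mul_I_re, ofReal_im, neg_zero]) 0 hk
    have hbound := (weylNorm_le_iff htop).1 le_rfl _ hmem
    rw [weylPairing_fourier hg s hk, eLpNorm_entireGaussian_imaginary_mul, ← eLpNorm_fourier_eq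
      (gaussianSpan_integrable hk) (gaussianSpan_memLp hk), hkh] at hbound
    rwa [ENNReal.coe_toNNReal htop]

lemma weylNorm_fourier_eq (hg : IsFreeEvolution f t g) (s : EuclideanSpace ℝ ι) :
    weylNorm (𝓕 f) ((4 * Real.pi * t) • s) (-(2 * Real.pi)⁻¹ • s) = exponentialNorm s g :=
  (weylNorm_le_exponentialNorm hg s).antisymm (exponentialNorm_le_weylNorm hg s)

lemma weylNorm_zero_right_le (f : Lp ℂ 2 (volume : Measure (EuclideanSpace ℝ ι)))
    (s : EuclideanSpace ℝ ι) : weylNorm f s 0 ≤ exponentialNorm s f := by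
  rcases eq_or_ne (exponentialNorm s f) ⊤ with htop | htop
  · exact htop ▸ le_top
  refine (weylNorm_le_iff htop).2 fun h hh => ?_
  have hzero : complexify (0 : EuclideanSpace ℝ ι) = 0 := by
    ext
    simp [complexify]
  have hpair : weylPairing f (complexify s) (complexify 0) h =
      ∫ x, (Real.exp (inner ℝ s x) * f x) * (h ∘ complexify) x := by
    refine integral_congr_ae (.of_forall fun x => ?_)
    simp only [hzero, weyl_apply, dotProduct_zero, complexify_dotProduct, smul_zero, add_zero,
      mul_zero, zero_div, zero_add, ofReal_exp, Function.comp_apply]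
    ring
  rw [hpair]
  exact enorm_integral_mul_le (aestronglyMeasurable_exp_inner_mul s (Lp.aestronglyMeasurable f))
    (gaussianSpan_memLp hh).1

lemma exponentialNorm_le_rpow_mul_rpow {g₀ g₁ : Lp ℂ 2 (volume : Measure (EuclideanSpace ℝ ι))}
    {t₀ t₁ θ r r₀ r₁ : ℝ} (hg₀ : IsFreeEvolution f t₀ g₀) (hg₁ : IsFreeEvolution f t₁ g₁)
    (hg : IsFreeEvolution f t g) (hθ₀ : 0 ≤ θ) (hθ₁ : θ ≤ 1)
    (hr : r = (1 - θ) * r₀ + θ * r₁) (ht : t * r = (1 - θ) * (t₀ * r₀) + θ * (t₁ * r₁))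
    (s : EuclideanSpace ℝ ι) :
    exponentialNorm (r • s) g ≤
      exponentialNorm (r₀ • s) g₀ ^ (1 - θ) * exponentialNorm (r₁ • s) g₁ ^ θ := by
  have hposition : (4 * Real.pi * t) • r • s =
      (1 - θ) • (4 * Real.pi * t₀) • r₀ • s + θ • (4 * Real.pi * t₁) • r₁ • s := by
    simp only [smul_smul, ← add_smul]
    congr 1
    linear_combination 4 * Real.pi * ht
  have hmomentum : -(2 * Real.pi)⁻¹ • r • s =
      (1 - θ) • (-(2 * Real.pi)⁻¹) • r₀ • s + θ • (-(2 * Real.pi)⁻¹) • r₁ • s := by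
    rw [hr]
    module
  rw [← weylNorm_fourier_eq hg, ← weylNorm_fourier_eq hg₀, ← weylNorm_fourier_eq hg₁, hposition,
    hmomentum]
  exact weylNorm_le_rpow_mul_rpow _ _ _ _ _ hθ₀ hθ₁

lemma exponentialNorm_le_rpow_mul_rpow_fourier
    {g₀ : Lp ℂ 2 (volume : Measure (EuclideanSpace ℝ ι))} {t₀ θ r r₀ r₁ : ℝ}
    (hg₀ : IsFreeEvolution f t₀ g₀) (hg : IsFreeEvolution f t g) (hθ₀ : 0 ≤ θ) (hθ₁ : θ ≤ 1)
    (hr : r = (1 - θ) * r₀) (ht : 4 * Real.pi * (t * r) =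
      (1 - θ) * (4 * Real.pi * (t₀ * r₀)) + θ * r₁) (s : EuclideanSpace ℝ ι) :
    exponentialNorm (r • s) g ≤
      exponentialNorm (r₀ • s) g₀ ^ (1 - θ) *
        exponentialNorm (r₁ • s) (𝓕 f : Lp ℂ 2 volume) ^ θ := by
  have hposition : (4 * Real.pi * t) • r • s =
      (1 - θ) • (4 * Real.pi * t₀) • r₀ • s + θ • r₁ • s := by
    simp only [smul_smul, ← add_smul]
    congr 1
    linear_combination ht
  have hmomentum : -(2 * Real.pi)⁻¹ • r • s =
      (1 - θ) • (-(2 * Real.pi)⁻¹) • r₀ • s + θ • (0 : EuclideanSpace ℝ ι) := by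
    rw [hr]
    module
  rw [← weylNorm_fourier_eq hg, ← weylNorm_fourier_eq hg₀, hposition, hmomentum]
  refine (weylNorm_le_rpow_mul_rpow _ _ _ _ _ hθ₀ hθ₁).trans ?_
  gcongr
  exact weylNorm_zero_right_le _ _

end ExponentialWeight

section GaussianAverage

open ProbabilityTheory

lemma enorm_exp_mul_sq (a : ℝ) (z : ℂ) :
    ‖(Real.exp a : ℂ) * z‖ₑ ^ (2 : ℝ) = ENNReal.ofReal (Real.exp (2 * a)) * ‖z‖ₑ ^ (2 : ℝ) := by
  rw [enorm_mul, ENNReal.mul_rpow_of_nonneg _ _ zero_le_two, ← ofReal_norm, Complex.norm_real,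
    Real.norm_of_nonneg (Real.exp_pos a).le,
    ENNReal.ofReal_rpow_of_nonneg (Real.exp_pos a).le zero_le_two, ← Real.exp_mul, mul_comm a]

lemma lintegral_exp_pi_gaussianReal {ι : Type*} [Fintype ι] (σ : ι → ℝ≥0) (a : ι → ℝ) :
    ∫⁻ s, ENNReal.ofReal (Real.exp (∑ j, a j * s j)) ∂(Measure.pi fun j => gaussianReal 0 (σ j)) =
      ENNReal.ofReal (Real.exp (∑ j, σ j * a j ^ 2 / 2)) := by
  have hint : ∀ j, Integrable (fun s : ℝ => Real.exp (a j * s)) (gaussianReal 0 (σ j)) :=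
    fun j => integrable_exp_mul_gaussianReal (a j)
  have hmgf : ∀ j, ∫ s, Real.exp (a j * s) ∂(gaussianReal 0 (σ j)) =
      Real.exp (σ j * a j ^ 2 / 2) := fun j => by
    simpa [mgf] using mgf_gaussianReal (p := gaussianReal 0 (σ j)) Measure.map_id (a j)
  simp_rw [Real.exp_sum]
  rw [← ofReal_integral_eq_lintegral_ofReal (Integrable.fintype_prod hint)
    (.of_forall fun s => by positivity),
    integral_fintype_prod_eq_prod (𝕜 := ℝ) (fun j s => Real.exp (a j * s))]
  simp_rw [hmgf]

variable {n : ℕ} {f : EuclideanSpace ℝ (Fin n) → ℂ}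

lemma exponentialNorm_sq (s : EuclideanSpace ℝ (Fin n)) (f : EuclideanSpace ℝ (Fin n) → ℂ) :
    exponentialNorm s f ^ (2 : ℝ) =
      ∫⁻ x, ENNReal.ofReal (Real.exp (2 * inner ℝ s x)) * ‖f x‖ₑ ^ (2 : ℝ) := by
  simp_rw [← enorm_exp_mul_sq]
  exact eLpNorm_nnreal_pow_eq_lintegral two_ne_zero

lemma aemeasurable_exp_inner_mul_sq (r : ℝ) (ν : Measure (Fin n → ℝ))
    (hf : AEStronglyMeasurable f) :
    AEMeasurable (fun p : (Fin n → ℝ) × EuclideanSpace ℝ (Fin n) =>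
      ENNReal.ofReal (Real.exp (2 * inner ℝ (r • WithLp.toLp 2 p.1) p.2)) *
        ‖f p.2‖ₑ ^ (2 : ℝ)) (ν.prod volume) :=
  (by fun_prop : Measurable fun p : (Fin n → ℝ) × EuclideanSpace ℝ (Fin n) =>
    ENNReal.ofReal (Real.exp (2 * inner ℝ (r • WithLp.toLp 2 p.1) p.2))).aemeasurable.mul
      (hf.comp_snd.enorm.pow_const 2)

lemma aemeasurable_exponentialNorm_sq (r : ℝ) (ν : Measure (Fin n → ℝ))
    (hf : AEStronglyMeasurable f) :
    AEMeasurable (fun s : Fin n → ℝ => exponentialNorm (r • WithLp.toLp 2 s) f ^ (2 : ℝ)) ν := by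
  simp_rw [exponentialNorm_sq]
  exact (aemeasurable_exp_inner_mul_sq r ν hf).lintegral_prod_right'

lemma gaussianNorm_sq (γ : Fin n → ℝ≥0) (r : ℝ) (hf : AEStronglyMeasurable f) :
    gaussianNorm (fun j => γ j * r ^ 2) f ^ (2 : ℝ) =
      ∫⁻ s, exponentialNorm (r • WithLp.toLp 2 s) f ^ (2 : ℝ)
        ∂(Measure.pi fun j => gaussianReal 0 (γ j)) := by
  have hsq : gaussianNorm (fun j => γ j * r ^ 2) f ^ (2 : ℝ) =
      ∫⁻ x, ENNReal.ofReal (Real.exp (2 * ∑ j, γ j * r ^ 2 * x j ^ 2)) * ‖f x‖ₑ ^ (2 : ℝ) := by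
    simp_rw [← enorm_exp_mul_sq]
    exact eLpNorm_nnreal_pow_eq_lintegral two_ne_zero
  have hlaplace : ∀ x : EuclideanSpace ℝ (Fin n),
      ∫⁻ s, ENNReal.ofReal (Real.exp (2 * inner ℝ (r • WithLp.toLp 2 s) x))
        ∂(Measure.pi fun j => gaussianReal 0 (γ j)) =
      ENNReal.ofReal (Real.exp (2 * ∑ j, γ j * r ^ 2 * x j ^ 2)) := by
    intro x
    have hinner : ∀ s : Fin n → ℝ,
        2 * inner ℝ (r • WithLp.toLp 2 s) x = ∑ j, 2 * r * x j * s j := by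
      intro s
      simp only [PiLp.inner_apply, Finset.mul_sum, PiLp.smul_apply, RCLike.inner_apply,
        conj_trivial, smul_eq_mul]
      exact Finset.sum_congr rfl fun j _ => by ring
    simp_rw [hinner, lintegral_exp_pi_gaussianReal, Finset.mul_sum]
    congr! 3 with j
    ring
  simp_rw [hsq, exponentialNorm_sq]
  rw [lintegral_lintegral_swap (aemeasurable_exp_inner_mul_sq r _ hf)]
  refine lintegral_congr fun x => ?_
  rw [lintegral_mul_const _ (by fun_prop), hlaplace]

/-- Hölder's inequality carries a logarithmic convexity inequality over to Gaussian averages. -/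
lemma gaussianNorm_le_of_exponentialNorm_le (γ : Fin n → ℝ≥0) {r r₀ r₁ θ : ℝ} (hθ₀ : 0 ≤ θ)
    (hθ₁ : θ ≤ 1) {f₀ f₁ : EuclideanSpace ℝ (Fin n) → ℂ} (hf : AEStronglyMeasurable f)
    (hf₀ : AEStronglyMeasurable f₀) (hf₁ : AEStronglyMeasurable f₁)
    (h : ∀ s, exponentialNorm (r • s) f ≤
      exponentialNorm (r₀ • s) f₀ ^ (1 - θ) * exponentialNorm (r₁ • s) f₁ ^ θ) :
    gaussianNorm (fun j => γ j * r ^ 2) f ≤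
      gaussianNorm (fun j => γ j * r₀ ^ 2) f₀ ^ (1 - θ) *
        gaussianNorm (fun j => γ j * r₁ ^ 2) f₁ ^ θ := by
  have hsq : ∀ a b : ℝ≥0∞, (a ^ (1 - θ) * b ^ θ) ^ (2 : ℝ) =
      (a ^ (2 : ℝ)) ^ (1 - θ) * (b ^ (2 : ℝ)) ^ θ := by
    intro a b
    rw [ENNReal.mul_rpow_of_nonneg _ _ zero_le_two]
    simp only [← ENNReal.rpow_mul, mul_comm (2 : ℝ)]
  rw [← ENNReal.rpow_le_rpow_iff (zero_lt_two (α := ℝ)), hsq, gaussianNorm_sq γ r hf,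
    gaussianNorm_sq γ r₀ hf₀, gaussianNorm_sq γ r₁ hf₁]
  refine (lintegral_mono fun s => ?_).trans (ENNReal.lintegral_mul_norm_pow_le
    (aemeasurable_exponentialNorm_sq r₀ _ hf₀) (aemeasurable_exponentialNorm_sq r₁ _ hf₁)
    (sub_nonneg.2 hθ₁) hθ₀ (sub_add_cancel 1 θ))
  exact (ENNReal.rpow_le_rpow (h _) zero_le_two).trans_eq (hsq _ _)

end GaussianAverage

section GaussianWeight

variable {n : ℕ} {f g g₀ g₁ : L2Space n} {t t₀ t₁ θ r r₀ r₁ : ℝ}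

lemma gaussianNorm_le_rpow_mul_rpow (γ : Fin n → ℝ≥0) (hg₀ : IsFreeEvolution f t₀ g₀)
    (hg₁ : IsFreeEvolution f t₁ g₁) (hg : IsFreeEvolution f t g) (hθ₀ : 0 ≤ θ) (hθ₁ : θ ≤ 1)
    (hr : r = (1 - θ) * r₀ + θ * r₁) (ht : t * r = (1 - θ) * (t₀ * r₀) + θ * (t₁ * r₁)) :
    gaussianNorm (fun j => γ j * r ^ 2) g ≤
      gaussianNorm (fun j => γ j * r₀ ^ 2) g₀ ^ (1 - θ) *
        gaussianNorm (fun j => γ j * r₁ ^ 2) g₁ ^ θ :=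
  gaussianNorm_le_of_exponentialNorm_le γ hθ₀ hθ₁ (Lp.aestronglyMeasurable _)
    (Lp.aestronglyMeasurable _) (Lp.aestronglyMeasurable _)
    (exponentialNorm_le_rpow_mul_rpow hg₀ hg₁ hg hθ₀ hθ₁ hr ht)

lemma gaussianNorm_le_rpow_mul_rpow_fourier (γ : Fin n → ℝ≥0) (hg₀ : IsFreeEvolution f t₀ g₀)
    (hg : IsFreeEvolution f t g) (hθ₀ : 0 ≤ θ) (hθ₁ : θ ≤ 1) (hr : r = (1 - θ) * r₀)
    (ht : 4 * Real.pi * (t * r) = (1 - θ) * (4 * Real.pi * (t₀ * r₀)) + θ * r₁) :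
    gaussianNorm (fun j => γ j * r ^ 2) g ≤
      gaussianNorm (fun j => γ j * r₀ ^ 2) g₀ ^ (1 - θ) *
        gaussianNorm (fun j => γ j * r₁ ^ 2) (𝓕 f : L2Space n) ^ θ :=
  gaussianNorm_le_of_exponentialNorm_le γ hθ₀ hθ₁ (Lp.aestronglyMeasurable _)
    (Lp.aestronglyMeasurable _) (Lp.aestronglyMeasurable _)
    (exponentialNorm_le_rpow_mul_rpow_fourier hg₀ hg hθ₀ hθ₁ hr ht)

end GaussianWeight

section ProductRule

open Asymptotics Topology

variable {𝕜 E F G : Type*} [NontriviallyNormedField 𝕜]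
  [SeminormedAddCommGroup E] [NormedSpace 𝕜 E] [SeminormedAddCommGroup F] [NormedSpace 𝕜 F]
  [NormedAddCommGroup G] [NormedSpace 𝕜 G] [NormedSpace ℝ G]

/-- A product rule in which the factors are only weakly differentiable: the error term
`B (W s - W t) (q s - q t)` is `o(s - t)`. -/
lemma hasDerivAt_bilinear_of_weak (B : E →L[𝕜] F →L[𝕜] G) {W : ℝ → E} {q : ℝ → F} {t : ℝ}
    {a b : G}
    (hW : ContinuousAt W t) (hq : (fun s => q s - q t) =O[𝓝 t] fun s => s - t)
    (ha : HasDerivAt (fun s => B (W s) (q t)) a t) (hb : HasDerivAt (fun s => B (W t) (q s)) b t) :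
    HasDerivAt (fun s => B (W s) (q s)) (a + b) t := by
  have herror : HasDerivAt (fun s => B (W s - W t) (q s - q t)) 0 t := by
    have hWt : (fun s => W s - W t) =o[𝓝 t] fun _ => (1 : ℝ) := by
      rw [isLittleO_one_iff, tendsto_sub_nhds_zero_iff]
      exact hW
    rw [hasDerivAt_iff_isLittleO]
    simp only [sub_self, map_zero, smul_zero, sub_zero]
    refine (B.isBoundedBilinearMap.isBigO_comp (g := fun s => W s - W t)
      (h := fun s => q s - q t) (l := 𝓝 t)).trans_isLittleO ?_
    simpa only [one_mul, norm_norm] using (hWt.norm_left.mul_isBigO hq.norm_left)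
  have hsum := ((ha.add hb).sub_const (B (W t) (q t))).add herror
  rw [add_zero] at hsum
  refine hsum.congr_of_eventuallyEq (.of_forall fun s => ?_)
  simp only [Pi.add_apply, map_sub, sub_apply]
  abel

end ProductRule

section Multiplier

open Complex

lemma hasTemperateGrowth_exp_ofReal_mul_I :
    (fun x : ℝ => exp (x * I)).HasTemperateGrowth := by
  have hiter : ∀ k : ℕ, iteratedDeriv k (fun x : ℝ => exp (x * I)) =
      fun x : ℝ => I ^ k * exp (x * I) := by
    intro k
    induction k with
    | zero => simp
    | succ k ih =>
      rw [iteratedDeriv_succ, ih]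
      ext x
      have hexp : HasDerivAt (fun x : ℝ => exp (x * I)) (exp (x * I) * I) x := by
        simpa using ((hasDerivAt_id x).ofReal_comp.mul_const I).cexp
      rw [(hexp.const_mul (I ^ k)).deriv]
      ring
  refine ⟨(ofRealCLM.contDiff.mul contDiff_const).cexp, fun k => ⟨0, 1, fun x => ?_⟩⟩
  rw [norm_iteratedFDeriv_eq_norm_iteratedDeriv, hiter, norm_mul, norm_pow, norm_I,
    norm_exp_ofReal_mul_I, one_pow, one_mul, pow_zero, mul_one]

lemma schrodingerPhase_zero {V : Type*} [Norm V] (η : V) : schrodingerPhase 0 η = 1 := by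
  simp [schrodingerPhase]

lemma schrodingerPhase_add {V : Type*} [Norm V] (s t : ℝ) (η : V) :
    schrodingerPhase (s + t) η = schrodingerPhase s η * schrodingerPhase t η := by
  rw [schrodingerPhase, schrodingerPhase, schrodingerPhase, ← exp_add]
  congr 1
  push_cast
  ring

lemma hasDerivAt_schrodingerPhase {V : Type*} [Norm V] (t : ℝ) (η : V) :
    HasDerivAt (fun s => schrodingerPhase s η)
      (-(I * (4 * Real.pi ^ 2 * ‖η‖ ^ 2 : ℝ)) * schrodingerPhase t η) t := by
  have hexp : HasDerivAt (fun s : ℝ => ((-(4 * Real.pi ^ 2 * s * ‖η‖ ^ 2) : ℝ) : ℂ) * I)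
      (-(I * (4 * Real.pi ^ 2 * ‖η‖ ^ 2 : ℝ))) t := by
    have := ((((hasDerivAt_id t).const_mul (4 * Real.pi ^ 2)).mul_const
      (‖η‖ ^ 2)).neg.ofReal_comp).mul_const I
    refine this.congr_deriv ?_
    push_cast
    ring
  exact hexp.cexp.congr_deriv (mul_comm _ _)

lemma norm_schrodingerPhase_sub_le {V : Type*} [Norm V] (s t : ℝ) (η : V) :
    ‖schrodingerPhase s η - schrodingerPhase t η‖ ≤ 4 * Real.pi ^ 2 * ‖η‖ ^ 2 * |s - t| := by
  refine convex_univ.norm_image_sub_le_of_norm_hasDerivWithin_le (fun r _ =>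
    (hasDerivAt_schrodingerPhase r η).hasDerivWithinAt) (fun r _ => ?_) trivial trivial
  rw [norm_mul, norm_neg, norm_mul, norm_I, norm_schrodingerPhase, norm_real,
    Real.norm_of_nonneg (by positivity), one_mul, mul_one]

variable {V : Type*} [NormedAddCommGroup V] [InnerProductSpace ℝ V]

lemma hasTemperateGrowth_schrodingerPhase (t : ℝ) :
    (schrodingerPhase t : V → ℂ).HasTemperateGrowth := by
  have : (fun η : V => -(4 * Real.pi ^ 2 * t * ‖η‖ ^ 2)).HasTemperateGrowth := by fun_prop
  exact hasTemperateGrowth_exp_ofReal_mul_I.comp this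

/-- Multiplication of Schwartz functions by `schrodingerPhase t`. -/
noncomputable def phaseMultiplier (t : ℝ) : 𝓢(V, ℂ) →L[ℂ] 𝓢(V, ℂ) :=
  SchwartzMap.smulLeftCLM ℂ (schrodingerPhase t)

lemma phaseMultiplier_apply (t : ℝ) (φ : 𝓢(V, ℂ)) (η : V) :
    phaseMultiplier t φ η = schrodingerPhase t η * φ η :=
  SchwartzMap.smulLeftCLM_apply_apply (hasTemperateGrowth_schrodingerPhase t) φ η

/-- Multiplication of Schwartz functions by the Fourier symbol `4π²|η|²` of `-Δ`. -/
noncomputable def symbolMultiplier : 𝓢(V, ℂ) →L[ℂ] 𝓢(V, ℂ) :=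
  SchwartzMap.smulLeftCLM ℂ fun η : V => (4 * Real.pi ^ 2 * ‖η‖ ^ 2 : ℝ)

lemma symbolMultiplier_apply (φ : 𝓢(V, ℂ)) (η : V) :
    symbolMultiplier φ η = (4 * Real.pi ^ 2 * ‖η‖ ^ 2 : ℝ) * φ η := by
  have hgrowth : (fun η : V => ((4 * Real.pi ^ 2 * ‖η‖ ^ 2 : ℝ) : ℂ)).HasTemperateGrowth := by
    fun_prop
  rw [symbolMultiplier, SchwartzMap.smulLeftCLM_apply_apply hgrowth, smul_eq_mul]

variable [FiniteDimensional ℝ V] [MeasurableSpace V] [BorelSpace V]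

lemma laplacian_fourier (φ : 𝓢(V, ℂ)) : Δ (𝓕 φ) = -𝓕 (symbolMultiplier φ) := by
  have hinner : ∀ v : V, (fun η : V => inner ℝ η v).HasTemperateGrowth := fun v => by fun_prop
  let b := stdOrthonormalBasis ℝ V
  simp_rw [SchwartzMap.laplacian_eq_sum b, SchwartzMap.lineDerivOp_fourier_eq]
  rw [← FourierTransform.fourier_neg, ← FourierTransform.fourier_sum]
  congr 1
  ext η
  simp only [sum_apply, neg_apply, smul_apply, smul_eq_mul, neg_mul, symbolMultiplier_apply,
    SchwartzMap.smulLeftCLM_apply_apply (hinner _), real_smul]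
  rw [← b.sum_sq_inner_left η]
  push_cast
  rw [Finset.mul_sum, Finset.sum_mul, ← Finset.sum_neg_distrib]
  refine Finset.sum_congr rfl fun i _ => ?_
  linear_combination (4 * Real.pi ^ 2 * (inner ℝ η (b i) : ℂ) ^ 2 * φ η) * I_sq

lemma exists_lipschitzWith_toLp_phaseMultiplier (φ : 𝓢(V, ℂ)) :
    ∃ K, LipschitzWith K fun s : ℝ => (phaseMultiplier s φ).toLp 2 (volume : Measure V) := by
  refine ⟨‖(symbolMultiplier φ).toLp 2 (volume : Measure V)‖₊,
    LipschitzWith.of_dist_le_mul fun s t => ?_⟩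
  rw [dist_eq_norm, mul_comm, Real.dist_eq, coe_nnnorm]
  refine Lp.norm_le_mul_norm_of_ae_le_mul ?_
  filter_upwards [Lp.coeFn_sub ((phaseMultiplier s φ).toLp 2 volume)
      ((phaseMultiplier t φ).toLp 2 volume),
    (phaseMultiplier s φ).coeFn_toLp 2 volume, (phaseMultiplier t φ).coeFn_toLp 2 volume,
    (symbolMultiplier φ).coeFn_toLp 2 volume] with η hsub hs ht hη
  rw [hsub, Pi.sub_apply, hs, ht, hη, phaseMultiplier_apply, phaseMultiplier_apply,
    symbolMultiplier_apply, ← sub_mul, norm_mul, norm_mul, norm_real,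
    Real.norm_of_nonneg (by positivity), ← mul_assoc]
  gcongr
  exact (norm_schrodingerPhase_sub_le s t η).trans_eq (mul_comm _ _)

lemma integrable_Lp_mul_schwartz (U : Lp ℂ 2 (volume : Measure V)) (φ : 𝓢(V, ℂ)) :
    Integrable fun x => U x * φ x :=
  (Lp.memLp U).integrable_mul (φ.memLp 2 volume)

lemma lpPairing_toLp (U : Lp ℂ 2 (volume : Measure V)) (φ : 𝓢(V, ℂ)) :
    (ContinuousLinearMap.mul ℂ ℂ).lpPairing volume 2 2 U (φ.toLp 2) = ∫ x, U x * φ x := by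
  rw [ContinuousLinearMap.lpPairing_eq_integral]
  exact integral_congr_ae (Filter.EventuallyEq.rfl.fun_mul (φ.coeFn_toLp 2 volume))

lemma hasDerivAt_integral_mul_phaseMultiplier (U : Lp ℂ 2 (volume : Measure V)) (φ : 𝓢(V, ℂ))
    (t : ℝ) :
    HasDerivAt (fun s => ∫ η, U η * phaseMultiplier (-s) φ η)
      (I * ∫ η, U η * symbolMultiplier (phaseMultiplier (-t) φ) η) t := by
  have hint := integrable_Lp_mul_schwartz U
  rw [← integral_const_mul]
  refine (hasDerivAt_integral_of_dominated_loc_of_deriv_le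
    (F' := fun s η => I * (U η * symbolMultiplier (phaseMultiplier (-s) φ) η))
    (bound := fun η => ‖U η * symbolMultiplier φ η‖) Filter.univ_mem
    (.of_forall fun s => (hint _).aestronglyMeasurable) (hint _)
    ((hint _).const_mul I).aestronglyMeasurable ?_ (hint _).norm ?_).2
  · refine .of_forall fun η s _ => le_of_eq ?_
    simp only [symbolMultiplier_apply, phaseMultiplier_apply, norm_mul, norm_schrodingerPhase,
      norm_I, one_mul]
  · refine .of_forall fun η s _ => ?_
    simp only [symbolMultiplier_apply, phaseMultiplier_apply]
    have hphase := (hasDerivAt_schrodingerPhase (-s) η).scomp s (hasDerivAt_neg s)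
    refine ((hphase.mul_const (φ η)).const_mul (U η)).congr_deriv ?_
    simp only [neg_smul, one_smul]
    ring

end Multiplier

section Evolution

open Complex

variable {n : ℕ} {u₀ : L2Space n} {u : ℝ → L2Space n} {t : ℝ}

lemma IsFreeSchrodingerSolution.continuousOn_fourier (hu : IsFreeSchrodingerSolution u₀ u) :
    ContinuousOn (fun s => (𝓕 (u s) : L2Space n)) (Set.Ici 0) :=
  (Lp.fourierTransformₗᵢ (EuclideanSpace ℝ (Fin n)) ℂ).continuous.comp_continuousOn hu.continuousOn

lemma IsFreeSchrodingerSolution.hasDerivAt_integral_fourier_mul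
    (hu : IsFreeSchrodingerSolution u₀ u) (φ : 𝓢(EuclideanSpace ℝ (Fin n), ℂ)) (ht : 0 < t) :
    HasDerivAt (fun s => ∫ η, (𝓕 (u s) : L2Space n) η * φ η)
      (-(I * ∫ η, (𝓕 (u t) : L2Space n) η * symbolMultiplier φ η)) t := by
  have h := hu.equation (𝓕 φ) t ht
  simp only [laplacian_fourier, neg_apply, mul_neg, integral_neg] at h
  simpa only [integral_Lp_fourier_mul_schwartz] using h

lemma IsFreeSchrodingerSolution.integral_fourier_mul_phaseMultiplier
    (hu : IsFreeSchrodingerSolution u₀ u) (φ : 𝓢(EuclideanSpace ℝ (Fin n), ℂ)) (ht : 0 ≤ t) :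
    ∫ η, (𝓕 (u t) : L2Space n) η * phaseMultiplier (-t) φ η =
      ∫ η, (𝓕 u₀ : L2Space n) η * φ η := by
  obtain ⟨K, hK⟩ := exists_lipschitzWith_toLp_phaseMultiplier φ
  let q : ℝ → L2Space n := fun s => (phaseMultiplier (-s) φ).toLp 2
  let B := (ContinuousLinearMap.mul ℂ ℂ).lpPairing (volume : Measure (EuclideanSpace ℝ (Fin n))) 2 2
  have hcont : ContinuousOn (fun s => B (𝓕 (u s) : L2Space n) (q s)) (Set.Ici 0) :=
    (B.continuous.comp_continuousOn hu.continuousOn_fourier).clm_apply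
      (hK.continuous.comp continuous_neg).continuousOn
  have hderiv : ∀ r, 0 < r → HasDerivAt (fun s => B (𝓕 (u s) : L2Space n) (q s)) 0 r := by
    intro r hr
    rw [← neg_add_cancel
      (I * ∫ η, (𝓕 (u r) : L2Space n) η * symbolMultiplier (phaseMultiplier (-r) φ) η)]
    refine hasDerivAt_bilinear_of_weak B (hu.continuousOn_fourier.continuousAt (Ici_mem_nhds hr))
      (.of_bound K (.of_forall fun s => ?_)) ?_ ?_
    · simpa only [← neg_sub', norm_neg] using hK.norm_sub_le (-s) (-r)
    · simpa only [B, q, lpPairing_toLp] using hu.hasDerivAt_integral_fourier_mul _ hr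
    · simpa only [B, q, lpPairing_toLp] using hasDerivAt_integral_mul_phaseMultiplier _ φ r
  have hconst := intervalIntegral.integral_eq_sub_of_hasDerivAt_of_le ht
    (hcont.mono Set.Icc_subset_Ici_self) (fun r hr => hderiv r hr.1) intervalIntegrable_const
  rw [intervalIntegral.integral_zero, eq_comm, sub_eq_zero] at hconst
  simpa only [B, q, lpPairing_toLp, phaseMultiplier_apply, neg_zero, schrodingerPhase_zero, one_mul,
    hu.initial] using hconst

theorem IsFreeSchrodingerSolution.isFreeEvolution (hu : IsFreeSchrodingerSolution u₀ u)
    (ht : 0 ≤ t) : IsFreeEvolution u₀ t (u t) := by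
  have hphase : MemLp (fun η => (𝓕 (u t) : L2Space n) η * schrodingerPhase (-t) η) 2 := by
    refine (Lp.memLp (𝓕 (u t) : L2Space n)).of_le ((Lp.aestronglyMeasurable _).mul
      (hasTemperateGrowth_schrodingerPhase _).1.continuous.aestronglyMeasurable)
      (.of_forall fun η => ?_)
    rw [norm_mul, norm_schrodingerPhase, mul_one]
  have hback : (fun η => (𝓕 (u t) : L2Space n) η * schrodingerPhase (-t) η) =ᵐ[volume]
      (𝓕 u₀ : L2Space n) := by
    refine ae_eq_of_integral_mul_schwartz_eq (hphase.locallyIntegrable one_le_two)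
      ((Lp.memLp _).locallyIntegrable one_le_two) fun φ _ => ?_
    simpa only [phaseMultiplier_apply, mul_assoc] using
      hu.integral_fourier_mul_phaseMultiplier φ ht
  rw [IsFreeEvolution]
  filter_upwards [hback] with η hη
  rw [← hη, mul_left_comm, ← schrodingerPhase_add, add_neg_cancel, schrodingerPhase_zero, mul_one]

end Evolution

section AngularFrequency

lemma eLpNorm_comp_smul {V F : Type*} [NormedAddCommGroup V] [NormedSpace ℝ V]
    [FiniteDimensional ℝ V] [MeasurableSpace V] [BorelSpace V] [NormedAddCommGroup F]
    (μ : Measure V) [μ.IsAddHaarMeasure] {p : ℝ≥0∞} (hp : p ≠ ⊤) {r : ℝ} (hr : 0 < r)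
    (f : V → F) :
    eLpNorm (fun x => f (r • x)) p μ =
      ENNReal.ofReal (r ^ (-(Module.finrank ℝ V : ℝ) / p.toReal)) * eLpNorm f p μ := by
  have hmap : eLpNorm (fun x => f (r • x)) p μ = eLpNorm f p (μ.map (r • ·)) :=
    ((Homeomorph.smulOfNeZero r hr.ne').measurableEmbedding.eLpNorm_map_measure).symm
  rw [hmap, Measure.map_addHaar_smul μ hr.ne', eLpNorm_smul_measure_of_ne_top hp, smul_eq_mul,
    abs_of_pos (by positivity), ENNReal.ofReal_rpow_of_nonneg (by positivity) (by positivity),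
    ← Real.rpow_natCast, ← Real.rpow_neg hr.le, ← Real.rpow_mul hr.le, ENNReal.toReal_div,
    ENNReal.toReal_one, mul_one_div]

lemma gaussianNorm_angularFourier {n : ℕ} (c : Fin n → ℝ) (f : L2Space n) :
    gaussianNorm c (angularFourier f) =
      gaussianNorm (fun j => c j * (2 * Real.pi) ^ 2) (𝓕 f : L2Space n) := by
  have hpi := Real.two_pi_pos
  let G : EuclideanSpace ℝ (Fin n) → ℂ := fun x =>
    (Real.exp (∑ j, c j * (2 * Real.pi) ^ 2 * x j ^ 2) : ℂ) * (𝓕 f : L2Space n) x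
  have hscale : (fun ξ : EuclideanSpace ℝ (Fin n) =>
      ((Real.exp (∑ j, c j * ξ j ^ 2) : ℝ) : ℂ) * angularFourier f ξ) =
      ((2 * Real.pi) ^ (-(n : ℝ) / 2)) • fun ξ => G ((2 * Real.pi)⁻¹ • ξ) := by
    ext ξ
    have hweight : ∀ j, c j * (2 * Real.pi) ^ 2 * ((2 * Real.pi)⁻¹ * ξ j) ^ 2 = c j * ξ j ^ 2 :=
      fun j => by field_simp
    simp only [G, angularFourier, Pi.smul_apply, PiLp.smul_apply, smul_eq_mul, hweight,
      Complex.real_smul]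
    ring
  rw [gaussianNorm, hscale, eLpNorm_const_smul,
    eLpNorm_comp_smul volume ENNReal.ofNat_ne_top (inv_pos.2 hpi), finrank_euclideanSpace_fin,
    ← mul_assoc, Real.enorm_of_nonneg (by positivity), ← ENNReal.ofReal_mul (by positivity),
    ENNReal.toReal_ofNat, Real.inv_rpow hpi.le, mul_inv_cancel₀ (by positivity),
    ENNReal.ofReal_one, one_mul, gaussianNorm]

end AngularFrequency

theorem corollary3p1 (n : ℕ) (α β : ℝ) (hα : 0 < α) (hβ : 0 < β)
    (u₀ : L2Space n) (u : ℝ → L2Space n) (hu : IsFreeSchrodingerSolution u₀ u)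
    (γ : Fin n → ℝ) (hγ : ∀ j, 0 ≤ γ j) :
    (∀ T : ℝ, 0 < T → ∀ t : ℝ, 0 ≤ t → t ≤ T →
      gaussianNorm (fun j => γ j / (α * t + β) ^ 2) (u t) ≤
        gaussianNorm (fun j => γ j / β ^ 2) (u 0) ^ (β * (T - t) / (T * (α * t + β))) *
        gaussianNorm (fun j => γ j / (α * T + β) ^ 2) (u T) ^
          (1 - β * (T - t) / (T * (α * t + β)))) ∧
    (∀ t : ℝ, 0 ≤ t →
      gaussianNorm (fun j => γ j / (α * t + β) ^ 2) (u t) ≤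
        gaussianNorm (fun j => γ j / β ^ 2) (u 0) ^ (β / (α * t + β)) *
        gaussianNorm (fun j => 4 * γ j / α ^ 2) (angularFourier (u 0)) ^
          (1 - β / (α * t + β))) := by
  lift γ to Fin n → ℝ≥0 using hγ
  have hu₀ := hu.isFreeEvolution le_rfl
  simp only [gaussianNorm_angularFourier, div_eq_mul_inv (γ _ : ℝ), ← inv_pow]
  have hfreq : ∀ j, 4 * (γ j : ℝ) / α ^ 2 * (2 * Real.pi) ^ 2 = γ j * (4 * Real.pi / α) ^ 2 :=
    fun j => by ring
  refine ⟨fun T hT t ht htT => ?_, fun t ht => ?_⟩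
  · have hθ : β * (T - t) / (T * (α * t + β)) = 1 - t * (α * T + β) / (T * (α * t + β)) := by
      field_simp
      ring
    have hθ₁ : t * (α * T + β) / (T * (α * t + β)) ≤ 1 := by
      rw [div_le_one (by positivity)]
      linarith [mul_le_mul_of_nonneg_right htT hβ.le]
    rw [hθ, sub_sub_cancel]
    exact gaussianNorm_le_rpow_mul_rpow γ hu₀ (hu.isFreeEvolution hT.le) (hu.isFreeEvolution ht)
      (by positivity) hθ₁ (by field_simp; ring) (by field_simp; ring)
  · have hθ : β / (α * t + β) = 1 - α * t / (α * t + β) := by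
      field_simp
      ring
    have hθ₁ : α * t / (α * t + β) ≤ 1 := div_le_one_of_le₀ (by linarith) (by positivity)
    simp only [hfreq, hu.initial]
    rw [hθ, sub_sub_cancel]
    exact gaussianNorm_le_rpow_mul_rpow_fourier γ (hu.initial ▸ hu₀) (hu.isFreeEvolution ht)
      (by positivity) hθ₁ (by field_simp; ring) (by field_simp; ring)
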